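/- Let $n\ge 1$ be an integer. A convex body in $\mathbb R^n$ is a compact convex set with nonempty interior. Let $B_m$ be the Euclidean unit ball of $\mathbb R^m$ and $\kappa_m=\mathrm{vol}_m(B_m)$ (so $\kappa_0=1$). For a compact convex set $K\subset\mathbb R^n$ (possibly empty or of lower dimension), the intrinsic volumes $V_0(K),\dots,V_n(K)$ are the coefficients in Steiner's formula $$\mathrm{vol}_n(K+\varepsilon B_n)=\sum_{j=0}^n \varepsilon^{n-j}\kappa_{n-j}V_j(K)\qquad\text{for all }\varepsilon\ge 0;$$ in particular $V_j(\varnothing)=0$. For $1\le j\le n$ let $$\genfrac{[}{]}{0pt}{}{n}{j}=\binom nj\frac{\kappa_n}{\kappa_j\kappa_{n-j}}$$ be the flag coefficient, let $\mathrm{Gr}(n,j)$ be the Grassmannian of $j$-dimensional linear subspaces of $\mathbb R^n$ with its rotation invariant Borel probability measure $\nu_j$, and let $K|H$ be the orthogonal projection of $K$ onto $H\in\mathrm{Gr}(n,j)$. For convex bodies $K,L$ put $$\delta_j(K,L)=\genfrac{[}{]}{0pt}{}{n}{j}\int_{\mathrm{Gr}(n,j)}\mathrm{vol}_j\big((K|H)\triangle(L|H)\big)\,d\nu_j(H),$$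 $$\rho_j(K,L)=2V_j([K,L])-V_j(K)-V_j(L),\qquad \Delta_j(K,L)=V_j(K)+V_j(L)-2V_j(K\cap L),$$ where $[K,L]$ is the convex hull of $K\cup L$ and $\triangle$ is the symmetric difference. Let $h_K(u)=\max_{x\in K}\langle x,u\rangle$ be the support function of $K$, and $\sigma$ the uniform probability measure on the unit sphere $\mathbb S^{n-1}$. Then for all convex bodies $K,L$ in $\mathbb R^n$ the following hold. (i) If $K\subset L$ and $1\le j\le n$, then $\delta_j(K,L)=\rho_j(K,L)=\Delta_j(K,L)=V_j(L)-V_j(K)$. (ii) $\delta_j(K,L)\le\min\{\rho_j(K,L),\Delta_j(K,L)\}$ for all $1\le j\le n$. (iii) $\delta_j(K,L)\ge|V_j(K)-V_j(L)|$ for all $1\le j\le n$. (iv) $\rho_n(K,L)\ge\delta_n(K,L)=\Delta_n(K,L)=\mathrm{vol}_n(K\triangle L)$. (v) If $K\cap L\ne\varnothing$, then $$\Delta_1(K,L)\ge\delta_1(K,L)=\rho_1(K,L)=2\genfrac{[}{]}{0pt}{}{n}{1}\int_{\mathbb S^{n-1}}|h_K(u)-h_L(u)|\,d\sigma(u).$$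 -/

import Mathlib

open MeasureTheory
open scoped Pointwise symmDiff

/-- A convex body in `ℝ^n`: a compact convex set with nonempty interior. -/
structure IsConvexBody {n : ℕ} (K : Set (EuclideanSpace ℝ (Fin n))) : Prop where
  isCompact : IsCompact K
  convex : Convex ℝ K
  interior_nonempty : (interior K).Nonempty

/-- `κ_m`, the volume of the unit ball of `ℝ^m` (so `κ_0 = 1`). -/
noncomputable def ballVolume (m : ℕ) : ℝ :=
  volume.real (Metric.closedBall (0 : EuclideanSpace ℝ (Fin m)) 1)

/-- The flag coefficient `binom(n, j) κ_n / (κ_j κ_{n-j})`, for `j ≤ n`. -/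
noncomputable def flagCoeff (n j : ℕ) : ℝ :=
  (n.choose j : ℝ) * (ballVolume n / (ballVolume j * ballVolume (n - j)))

/-- `V 0, …, V n` are the coefficients of `K` in Steiner's formula
`vol_n (K + ε B_n) = ∑_{j=0}^n ε^(n-j) κ_(n-j) V_j` for all `ε ≥ 0`; there is at most one such `V`. -/
def IsSteinerCoeff {n : ℕ} (K : Set (EuclideanSpace ℝ (Fin n))) (V : Fin (n + 1) → ℝ) : Prop :=
  ∀ ε : ℝ, 0 ≤ ε →
    volume.real (K + ε • Metric.closedBall (0 : EuclideanSpace ℝ (Fin n)) 1) =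
      ∑ j : Fin (n + 1), ε ^ (n - (j : ℕ)) * ballVolume (n - (j : ℕ)) * V j

open Classical in
/-- The `j`-th intrinsic volume `V_j(K)` of a convex compact set `K ⊆ ℝ^n`, `0 ≤ j ≤ n`: the
coefficient with index `j` in Steiner's formula. In particular `V_j(∅) = 0`.
(The value is `0` by convention for sets without a Steiner formula, and for `j > n`.) -/
noncomputable def intrinsicVolume {n : ℕ} (j : ℕ) (K : Set (EuclideanSpace ℝ (Fin n))) : ℝ :=
  if h : (∃ V, IsSteinerCoeff K V) ∧ j < n + 1 then h.1.choose ⟨j, h.2⟩ else 0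

/-- The Grassmannian `Gr(n, j)` of `j`-dimensional linear subspaces of `ℝ^n`. -/
@[ext]
structure Gr (n j : ℕ) where
  toSubmodule : Submodule ℝ (EuclideanSpace ℝ (Fin n))
  finrank_eq : Module.finrank ℝ toSubmodule = j

/-- The usual topology of `Gr(n, j)`, where a subspace is identified with the orthogonal
projection onto it. -/
noncomputable instance instTopologicalSpaceGr (n j : ℕ) : TopologicalSpace (Gr n j) :=
  TopologicalSpace.induced (fun H : Gr n j => H.1.starProjection) inferInstance

noncomputable instance instMeasurableSpaceGr (n j : ℕ) : MeasurableSpace (Gr n j) := borel _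

instance instBorelSpaceGr (n j : ℕ) : BorelSpace (Gr n j) := ⟨rfl⟩

noncomputable instance instMeasurableSpaceO (n : ℕ) : MeasurableSpace (Matrix.orthogonalGroup (Fin n) ℝ) :=
  borel _

instance instBorelSpaceO (n : ℕ) : BorelSpace (Matrix.orthogonalGroup (Fin n) ℝ) := ⟨rfl⟩

instance instCompactSpaceO (n : ℕ) : CompactSpace (Matrix.orthogonalGroup (Fin n) ℝ) := by
  refine isCompact_iff_compactSpace.mp ?_
  have hb : IsCompact (Set.pi Set.univ fun _ : Fin n =>
      Set.pi Set.univ fun _ : Fin n => Set.Icc (-1 : ℝ) 1) :=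
    isCompact_univ_pi fun _ => isCompact_univ_pi fun _ => isCompact_Icc
  refine IsCompact.of_isClosed_subset (X := Matrix (Fin n) (Fin n) ℝ) hb ?_ ?_
  · exact isClosed_unitary (R := Matrix (Fin n) (Fin n) ℝ)
  · intro g hg i _ k _
    have h := entry_norm_bound_of_unitary (𝕜 := ℝ) hg i k
    rw [Real.norm_eq_abs] at h
    exact abs_le.mp h

/-- The image `g H` of a subspace `H` under an orthogonal transformation `g`. -/
noncomputable def rotateGr {n j : ℕ} (H : Gr n j) (g : Matrix.orthogonalGroup (Fin n) ℝ) : Gr n j :=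
  ⟨H.1.map (Matrix.toEuclideanLin g.1), by
    have hinj : Function.Injective (Matrix.toEuclideanLin g.1) := by
      intro x y hxy
      have hg : (star g.1 : Matrix (Fin n) (Fin n) ℝ) * g.1 = 1 := (Unitary.mem_iff.mp g.2).1
      have h2 : g.1.mulVec x.ofLp = g.1.mulVec y.ofLp := by
        simpa [Matrix.toLpLin_apply] using hxy
      have h3 := congrArg (fun v => (star g.1 : Matrix (Fin n) (Fin n) ℝ).mulVec v) h2
      simp only [Matrix.mulVec_mulVec, hg, Matrix.one_mulVec] at h3
      exact WithLp.ofLp_injective 2 h3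
    exact (LinearEquiv.finrank_eq (Submodule.equivMapOfInjective _ hinj H.1)).symm.trans H.2⟩

/-- The subspace of `ℝ^n` spanned by the first `j` standard basis vectors. -/
noncomputable def coordGr {n j : ℕ} (h : j ≤ n) : Gr n j :=
  ⟨Submodule.span ℝ (Set.range fun i : Fin j =>
      EuclideanSpace.basisFun (Fin n) ℝ (Fin.castLE h i)), by
    have := finrank_span_eq_card (R := ℝ)
      (((EuclideanSpace.basisFun (Fin n) ℝ).orthonormal.linearIndependent).comp
        (Fin.castLE h) (Fin.castLE_injective h))
    simpa [Function.comp_def] using this⟩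

/-- `ν_j`, the `O(n)`-invariant Borel probability measure on `Gr(n, j)`, `j ≤ n`: the image of the
normalised Haar measure of the compact group `O(n)` under `g ↦ g H₀`, for a fixed `H₀`. -/
noncomputable def grMeasure (n j : ℕ) : Measure (Gr n j) :=
  if h : j ≤ n then
    (Measure.haarMeasure (⊤ : TopologicalSpace.PositiveCompacts
      (Matrix.orthogonalGroup (Fin n) ℝ))).map (rotateGr (coordGr h))
  else 0

/-- The orthogonal projection `K | H`, as a subset of `H`. -/
noncomputable def shadow {n : ℕ} (K : Set (EuclideanSpace ℝ (Fin n)))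
    (H : Submodule ℝ (EuclideanSpace ℝ (Fin n))) : Set H :=
  H.orthogonalProjectionOnto '' K

/-- `δ_j(K, L)`, the `j`-th intrinsic volume metric: the flag coefficient times the mean over
`Gr(n, j)` of the `j`-dimensional volume (`volume` on the Euclidean space `H`) of
`(K | H) ∆ (L | H)`. -/
noncomputable def ivMetric {n : ℕ} (j : ℕ) (K L : Set (EuclideanSpace ℝ (Fin n))) : ℝ :=
  flagCoeff n j * ∫ H : Gr n j, volume.real (shadow K H.1 ∆ shadow L H.1) ∂(grMeasure n j)

/-- `ρ_j(K, L) = 2 V_j([K, L]) - V_j(K) - V_j(L)`, where `[K, L]` is the convex hull of `K ∪ L`. -/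
noncomputable def ivHullDist {n : ℕ} (j : ℕ) (K L : Set (EuclideanSpace ℝ (Fin n))) : ℝ :=
  2 * intrinsicVolume j (convexHull ℝ (K ∪ L)) - intrinsicVolume j K - intrinsicVolume j L

/-- `Δ_j(K, L) = V_j(K) + V_j(L) - 2 V_j(K ∩ L)`, the `j`-th intrinsic volume deviation. -/
noncomputable def ivDeviation {n : ℕ} (j : ℕ) (K L : Set (EuclideanSpace ℝ (Fin n))) : ℝ :=
  intrinsicVolume j K + intrinsicVolume j L - 2 * intrinsicVolume j (K ∩ L)

/-- The support function `h_K(u) = max_{x ∈ K} ⟨x, u⟩` of a nonempty compact set `K`. -/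
noncomputable def supportFn {n : ℕ} (K : Set (EuclideanSpace ℝ (Fin n)))
    (u : EuclideanSpace ℝ (Fin n)) : ℝ :=
  sSup ((fun x => inner ℝ x u) '' K)

/-- `σ`, the uniform probability measure on the unit sphere of `ℝ^n`, `n ≥ 1`. -/
noncomputable def sphereUniform (n : ℕ) :
    Measure (Metric.sphere (0 : EuclideanSpace ℝ (Fin n)) 1) :=
  ((volume : Measure (EuclideanSpace ℝ (Fin n))).toSphere Set.univ)⁻¹ •
    (volume : Measure (EuclideanSpace ℝ (Fin n))).toSphere

/-! ### The orthogonal group -/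

section OrthogonalGroup

variable {n : ℕ}

/-! Everything rests on Kubota's formula (`intrinsicVolume_eq`): for a compact convex `C`, `V_j(C)`
is the flag coefficient times `meanShadow j C`, the mean `j`-volume of the projections of `C`.
Granting it, `δ_j`, `ρ_j` and `Δ_j` are the same nonnegative constant times combinations of mean
shadows. Projection commutes with unions, so `δ_j` corresponds to `2 m(K ∪ L) - m(K) - m(L)`
(`ivMetric_eq`). Monotonicity for `K ∪ L ⊆ [K, L]` compares it with `ρ_j`. Inclusion-exclusion, with
`(K ∩ L)|H ⊆ K|H ∩ L|H`, compares it with `Δ_j`. For `j = n` projecting loses nothing and the second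
comparison is an equality. For `j = 1` and `K ∩ L ≠ ∅` the shadows are overlapping intervals, so `K
∪ L` and `[K, L]` have the same shadows. Their lengths are `h(u) + h(-u)`, and `|h_K - h_L| = 2
max(h_K, h_L) - h_K - h_L` with `max(h_K, h_L) = h_[K,L]`.

Kubota's formula is proved together with Steiner's by way of zonotopes. By Fubini, adding a segment
`[0, s]` to `C` increases the volume of `C|H` by the length of `s|H` times the volume of `C|(H ∩
s^⊥)` (`volume_shadow_add_segment`). Iterating over the segments of a zonotope `Z` and averaging
over rotations of `C` gives the mean volume of `gC + Z` as a sum of `a_k m_k(C)`, where `a_k ≥ 0`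
depends on `Z` only. The unit ball is squeezed between translates of zonotopes and of slightly
larger balls (`exists_zonotope_near_ball`), and compactness of the coefficients yields `vol(C + B) =
∑ a_k m_k(C)` with universal `a_k` (`exists_coeff_steiner`). Inserting balls for `C` determines the
`a_k`, dilation produces Steiner's polynomial, and its coefficients are unique. -/

instance secondCountableTopologyO (n : ℕ) :
    SecondCountableTopology (Matrix.orthogonalGroup (Fin n) ℝ) :=
  haveI : SecondCountableTopology (Matrix (Fin n) (Fin n) ℝ) :=
    inferInstanceAs (SecondCountableTopology (Fin n → Fin n → ℝ))
  TopologicalSpace.Subtype.secondCountableTopology _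

instance polishSpaceO (n : ℕ) : PolishSpace (Matrix.orthogonalGroup (Fin n) ℝ) :=
  haveI : PolishSpace (Matrix (Fin n) (Fin n) ℝ) :=
    inferInstanceAs (PolishSpace (Fin n → Fin n → ℝ))
  (isClosed_unitary (R := Matrix (Fin n) (Fin n) ℝ)).polishSpace

/-- The linear isometry of `ℝ^n` given by an orthogonal matrix. -/
noncomputable def rot (g : Matrix.orthogonalGroup (Fin n) ℝ) :
    EuclideanSpace ℝ (Fin n) ≃ₗᵢ[ℝ] EuclideanSpace ℝ (Fin n) where
  toFun := Matrix.toEuclideanLin g.1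
  map_add' := map_add _
  map_smul' := map_smul _
  invFun := Matrix.toEuclideanLin (star g.1)
  left_inv x := by
    have hg : star g.1 * g.1 = 1 := (Unitary.mem_iff.mp g.2).1
    simp [Matrix.toLpLin_apply, Matrix.mulVec_mulVec, hg]
  right_inv x := by
    have hg : g.1 * star g.1 = 1 := (Unitary.mem_iff.mp g.2).2
    simp [Matrix.toLpLin_apply, Matrix.mulVec_mulVec, hg]
  norm_map' x := by
    have hg : star g.1 * g.1 = 1 := (Unitary.mem_iff.mp g.2).1
    have h : inner ℝ (Matrix.toEuclideanLin g.1 x) (Matrix.toEuclideanLin g.1 x) =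
        inner ℝ x x := by
      rw [← LinearMap.adjoint_inner_right, ← Matrix.toEuclideanLin_conjTranspose_eq_adjoint,
        ← Matrix.star_eq_conjTranspose]
      simp [Matrix.toLpLin_apply, Matrix.mulVec_mulVec, hg]
    rw [real_inner_self_eq_norm_sq, real_inner_self_eq_norm_sq] at h
    exact (sq_eq_sq₀ (norm_nonneg _) (norm_nonneg _)).1 h

theorem rot_apply (g : Matrix.orthogonalGroup (Fin n) ℝ) (x : EuclideanSpace ℝ (Fin n)) :
    rot g x = WithLp.toLp 2 (g.1.mulVec x.ofLp) := rfl

theorem rot_mul_apply (g h : Matrix.orthogonalGroup (Fin n) ℝ)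
    (x : EuclideanSpace ℝ (Fin n)) : rot (g * h) x = rot g (rot h x) := by
  simp [rot_apply, Matrix.mulVec_mulVec]

theorem rot_one_apply (x : EuclideanSpace ℝ (Fin n)) :
    rot (1 : Matrix.orthogonalGroup (Fin n) ℝ) x = x := by
  simp [rot_apply]

theorem rot_inv_apply_rot (g : Matrix.orthogonalGroup (Fin n) ℝ)
    (x : EuclideanSpace ℝ (Fin n)) : rot g⁻¹ (rot g x) = x := by
  rw [← rot_mul_apply, inv_mul_cancel, rot_one_apply]

theorem rot_apply_rot_inv (g : Matrix.orthogonalGroup (Fin n) ℝ)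
    (x : EuclideanSpace ℝ (Fin n)) : rot g (rot g⁻¹ x) = x := by
  rw [← rot_mul_apply, mul_inv_cancel, rot_one_apply]

theorem Continuous.rot_apply {X : Type*} [TopologicalSpace X]
    {f : X → Matrix.orthogonalGroup (Fin n) ℝ} {x : X → EuclideanSpace ℝ (Fin n)}
    (hf : Continuous f) (hx : Continuous x) : Continuous fun t => rot (f t) (x t) := by
  simp only [_root_.rot_apply]
  exact (PiLp.continuous_toLp 2 _).comp (Continuous.matrix_mulVec
    (continuous_subtype_val.comp hf) ((PiLp.continuous_ofLp 2 _).comp hx))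

theorem exists_rot_eq (e : EuclideanSpace ℝ (Fin n) ≃ₗᵢ[ℝ] EuclideanSpace ℝ (Fin n)) :
    ∃ g : Matrix.orthogonalGroup (Fin n) ℝ, ∀ x, rot g x = e x := by
  set A : Matrix (Fin n) (Fin n) ℝ := Matrix.toEuclideanLin.symm e.toLinearEquiv.toLinearMap with hA
  have hAe : Matrix.toEuclideanLin A = e.toLinearEquiv.toLinearMap := by simp [hA]
  have hmem : A ∈ Matrix.orthogonalGroup (Fin n) ℝ := by
    rw [Matrix.mem_orthogonalGroup_iff']
    apply Matrix.toEuclideanLin.injective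
    refine LinearMap.ext fun x => ext_inner_right ℝ fun y => ?_
    have h1 : Matrix.toEuclideanLin (A.transpose * A) x =
        LinearMap.adjoint (Matrix.toEuclideanLin A) (Matrix.toEuclideanLin A x) := by
      rw [← Matrix.toEuclideanLin_conjTranspose_eq_adjoint]
      simp [Matrix.conjTranspose_eq_transpose_of_trivial]
    have h2 : Matrix.toEuclideanLin (1 : Matrix (Fin n) (Fin n) ℝ) x = x := by
      simp
    rw [h1, h2, LinearMap.adjoint_inner_left, hAe]
    exact e.inner_map_map x y
  refine ⟨⟨A, hmem⟩, fun x => ?_⟩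
  exact congrArg (fun f => f x) hAe

/-- The normalised Haar measure of the orthogonal group. -/
noncomputable abbrev haarO (n : ℕ) : Measure (Matrix.orthogonalGroup (Fin n) ℝ) :=
  Measure.haarMeasure (⊤ : TopologicalSpace.PositiveCompacts (Matrix.orthogonalGroup (Fin n) ℝ))

instance isProbabilityMeasure_haarO (n : ℕ) : IsProbabilityMeasure (haarO n) :=
  ⟨Measure.haarMeasure_self
    (K₀ := (⊤ : TopologicalSpace.PositiveCompacts (Matrix.orthogonalGroup (Fin n) ℝ)))⟩

theorem eq_haarO_of_isMulLeftInvariant (μ : Measure (Matrix.orthogonalGroup (Fin n) ℝ))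
    [IsProbabilityMeasure μ] [μ.IsMulLeftInvariant] : μ = haarO n := by
  have h := Measure.isMulInvariant_eq_smul_of_compactSpace μ (haarO n)
  have h2 : μ Set.univ = (μ.haarScalarFactor (haarO n) • haarO n) Set.univ := by rw [← h]
  rw [Measure.smul_apply, measure_univ, measure_univ] at h2
  have h3 : μ.haarScalarFactor (haarO n) = 1 := by
    simpa [ENNReal.smul_def, eq_comm] using h2
  rw [h, h3, one_smul]

/-- Right translations commute with left ones, so they carry the Haar measure to a left invariant
probability measure, which is the Haar measure again. -/
instance isMulRightInvariant_haarO (n : ℕ) : (haarO n).IsMulRightInvariant where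
  map_mul_right_eq_self g := by
    have : IsProbabilityMeasure ((haarO n).map (· * g)) :=
      Measure.isProbabilityMeasure_map (measurable_mul_const g).aemeasurable
    exact eq_haarO_of_isMulLeftInvariant _

end OrthogonalGroup

/-! ### Shadows and the Grassmannian -/

section Grassmannian

variable {n j : ℕ}

theorem shadow_image_linearIsometryEquiv (e : EuclideanSpace ℝ (Fin n) ≃ₗᵢ[ℝ] EuclideanSpace ℝ (Fin n))
    (H : Submodule ℝ (EuclideanSpace ℝ (Fin n))) (C : Set (EuclideanSpace ℝ (Fin n))) :
    shadow (e '' C) (H.map e.toLinearEquiv.toLinearMap) = e.submoduleMap H '' shadow C H := by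
  rw [shadow, shadow, Set.image_image, Set.image_image]
  refine Set.image_congr' fun x => Subtype.ext ?_
  exact (e.toLinearIsometry.map_starProjection H x).symm

theorem volume_shadow_image (e : EuclideanSpace ℝ (Fin n) ≃ₗᵢ[ℝ] EuclideanSpace ℝ (Fin n))
    (H : Submodule ℝ (EuclideanSpace ℝ (Fin n))) (C : Set (EuclideanSpace ℝ (Fin n))) :
    volume (shadow (e '' C) (H.map e.toLinearEquiv.toLinearMap)) = volume (shadow C H) := by
  rw [shadow_image_linearIsometryEquiv]
  have h := (e.submoduleMap H).symm.measurePreserving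
  have h2 := h.measure_preimage_equiv (f := (e.submoduleMap H).symm.toMeasurableEquiv)
    (shadow C H)
  rw [← h2]
  congr 1
  exact (e.submoduleMap H).toEquiv.image_eq_preimage_symm (shadow C H)

theorem rotateGr_toSubmodule (H : Gr n j) (g : Matrix.orthogonalGroup (Fin n) ℝ) :
    (rotateGr H g).1 = H.1.map (rot g).toLinearEquiv.toLinearMap := rfl

theorem rotateGr_mul (H : Gr n j) (g h : Matrix.orthogonalGroup (Fin n) ℝ) :
    rotateGr H (g * h) = rotateGr (rotateGr H h) g := by
  apply Gr.ext
  rw [rotateGr_toSubmodule, rotateGr_toSubmodule, rotateGr_toSubmodule, ← Submodule.map_comp]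
  congr 1
  ext1 x
  exact rot_mul_apply g h x

theorem volume_shadow_rotateGr (H : Gr n j) (g : Matrix.orthogonalGroup (Fin n) ℝ)
    (C : Set (EuclideanSpace ℝ (Fin n))) :
    volume (shadow C (rotateGr H g).1) = volume (shadow (rot g⁻¹ '' C) H.1) := by
  rw [rotateGr_toSubmodule, ← volume_shadow_image (rot g) H.1 (rot g⁻¹ '' C), Set.image_image]
  simp [rot_apply_rot_inv]

/-- Matching orthonormal bases gives an isometry from `H` to `H'`, which extends to the whole space.
This transitivity makes the base point of `grMeasure` immaterial. -/
theorem exists_rotateGr_eq (H H' : Gr n j) : ∃ g, rotateGr H g = H' := by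
  let e : H.1 ≃ₗᵢ[ℝ] H'.1 :=
    (stdOrthonormalBasis ℝ H.1).repr.trans
      ((stdOrthonormalBasis ℝ H'.1).reindex
        (finCongr (H'.2.trans H.2.symm))).repr.symm
  let f := (H'.1.subtypeₗᵢ.comp e.toLinearIsometry).extend
  obtain ⟨g, hg⟩ := exists_rot_eq (f.toLinearIsometryEquiv rfl)
  have hfe : ∀ x : H.1, rot g x = e x := fun x => by
    rw [hg]
    exact LinearIsometry.extend_apply _ x
  refine ⟨g, Gr.ext ?_⟩
  rw [rotateGr_toSubmodule]
  ext y
  constructor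
  · rintro ⟨x, hx, rfl⟩
    have := hfe ⟨x, hx⟩
    change rot g x ∈ _
    rw [this]
    exact (e ⟨x, hx⟩).2
  · intro hy
    refine ⟨e.symm ⟨y, hy⟩, (e.symm ⟨y, hy⟩).2, ?_⟩
    change rot g _ = _
    rw [hfe]
    simp

theorem starProjection_rotateGr_apply (H : Gr n j) (g : Matrix.orthogonalGroup (Fin n) ℝ)
    (y : EuclideanSpace ℝ (Fin n)) :
    (rotateGr H g).1.starProjection y = rot g (H.1.starProjection (rot g⁻¹ y)) := by
  have h := (rot g).toLinearIsometry.map_starProjection H.1 (rot g⁻¹ y)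
  have h2 : (rot g).toLinearIsometry (rot g⁻¹ y) = y := rot_apply_rot_inv g y
  rw [h2] at h
  exact h.symm

theorem continuous_rotateGr (H : Gr n j) : Continuous (rotateGr H) := by
  refine continuous_induced_rng.2 (continuous_clm_apply.2 fun y => ?_)
  have h : (fun g => (rotateGr H g).1.starProjection y) =
      fun g => rot g (H.1.starProjection (rot g⁻¹ y)) :=
    funext fun g => starProjection_rotateGr_apply H g y
  have hc : Continuous fun g => rot g (H.1.starProjection (rot g⁻¹ y)) :=
    continuous_id.rot_apply (H.1.starProjection.continuous.comp
      (continuous_inv.rot_apply continuous_const))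
  rw [← h] at hc
  exact hc

theorem isEmbedding_starProjection :
    Topology.IsEmbedding (fun H : Gr n j => H.1.starProjection) where
  eq_induced := rfl
  injective H H' h := by
    apply Gr.ext
    have h' : H.1.starProjection = H'.1.starProjection := h
    rw [← Submodule.range_starProjection H.1, ← Submodule.range_starProjection H'.1, h']

instance secondCountableTopologyGr (n j : ℕ) : SecondCountableTopology (Gr n j) :=
  isEmbedding_starProjection.secondCountableTopology

instance t2SpaceGr (n j : ℕ) : T2Space (Gr n j) := isEmbedding_starProjection.t2Space

/-- Projection along a compact factor is a closed map. The sections of this closed set are the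
moving images of `C`, so their measures depend measurably on the parameter. -/
theorem isClosed_setOf_mem_image {X Y Z : Type*} [TopologicalSpace X] [TopologicalSpace Y]
    [TopologicalSpace Z] [T2Space Z] {C : Set Y} (hC : IsCompact C) {f : X × Y → Z}
    (hf : Continuous f) : IsClosed {p : X × Z | p.2 ∈ (fun y => f (p.1, y)) '' C} := by
  have := isCompact_iff_compactSpace.1 hC
  have h : {p : X × Z | p.2 ∈ (fun y => f (p.1, y)) '' C} =
      Prod.fst '' {q : (X × Z) × C | f (q.1.1, q.2) = q.1.2} := by
    ext ⟨x, z⟩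
    simp
  rw [h]
  refine isClosedMap_fst_of_compactSpace _ (isClosed_eq ?_ ?_) <;> fun_prop

theorem measurable_volume_shadow_rot {C : Set (EuclideanSpace ℝ (Fin n))} (hC : IsCompact C)
    (H : Submodule ℝ (EuclideanSpace ℝ (Fin n))) :
    Measurable fun g : Matrix.orthogonalGroup (Fin n) ℝ => volume (shadow (rot g⁻¹ '' C) H) := by
  have himg : ∀ g : Matrix.orthogonalGroup (Fin n) ℝ, shadow (rot g⁻¹ '' C) H =
      Prod.mk g ⁻¹' {p : Matrix.orthogonalGroup (Fin n) ℝ × H |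
        p.2 ∈ (fun y => H.orthogonalProjectionOnto (rot p.1⁻¹ y)) '' C} := by
    intro g
    rw [shadow, Set.image_image]
    rfl
  simp only [himg]
  have hcl := isClosed_setOf_mem_image (X := Matrix.orthogonalGroup (Fin n) ℝ) (Z := H) hC
    (f := fun p => H.orthogonalProjectionOnto (rot p.1⁻¹ p.2))
    (H.orthogonalProjectionOnto.continuous.comp
      ((continuous_inv.comp continuous_fst).rot_apply continuous_snd))
  exact measurable_measure_prodMk_left (ν := (volume : Measure H)) hcl.measurableSet

theorem measurable_volume_shadow {C : Set (EuclideanSpace ℝ (Fin n))} (hC : IsCompact C) :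
    Measurable fun H : Gr n j => volume (shadow C H.1) := by
  by_cases hne : Nonempty (Gr n j)
  · obtain ⟨H₀⟩ := hne
    -- The orbit map is a measurable surjection from a Polish space onto a second countable
    -- Hausdorff one, so measurability may be tested after pulling back to the group.
    rw [← (continuous_rotateGr H₀).measurable.measurable_comp_iff_of_surjective
      (exists_rotateGr_eq H₀)]
    simpa only [Function.comp_def, volume_shadow_rotateGr] using
      measurable_volume_shadow_rot hC H₀.1
  · have := not_nonempty_iff.1 hne
    exact measurable_of_empty _

theorem measurable_volume_real_shadow {C : Set (EuclideanSpace ℝ (Fin n))} (hC : IsCompact C) :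
    Measurable fun H : Gr n j => volume.real (shadow C H.1) :=
  (measurable_volume_shadow hC).ennreal_toReal

theorem isCompact_shadow {C : Set (EuclideanSpace ℝ (Fin n))} (hC : IsCompact C)
    (H : Submodule ℝ (EuclideanSpace ℝ (Fin n))) : IsCompact (shadow C H) :=
  hC.image H.orthogonalProjectionOnto.continuous

theorem convex_shadow {C : Set (EuclideanSpace ℝ (Fin n))} (hC : Convex ℝ C)
    (H : Submodule ℝ (EuclideanSpace ℝ (Fin n))) : Convex ℝ (shadow C H) :=
  hC.linear_image H.orthogonalProjectionOnto.toLinearMap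

theorem shadow_mono {C D : Set (EuclideanSpace ℝ (Fin n))} (h : C ⊆ D)
    (H : Submodule ℝ (EuclideanSpace ℝ (Fin n))) : shadow C H ⊆ shadow D H :=
  Set.image_mono h

theorem volume_real_shadow_mono {C D : Set (EuclideanSpace ℝ (Fin n))} (h : C ⊆ D)
    (hD : IsCompact D) (H : Submodule ℝ (EuclideanSpace ℝ (Fin n))) :
    volume.real (shadow C H) ≤ volume.real (shadow D H) :=
  measureReal_mono (shadow_mono h H) (isCompact_shadow hD H).measure_lt_top.ne

theorem image_rot_closedBall (g : Matrix.orthogonalGroup (Fin n) ℝ) (r : ℝ) :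
    rot g '' Metric.closedBall 0 r = Metric.closedBall 0 r := by
  rw [LinearIsometryEquiv.image_closedBall, map_zero]

theorem exists_subset_closedBall {C : Set (EuclideanSpace ℝ (Fin n))} (hC : IsCompact C) :
    ∃ r : ℝ, C ⊆ Metric.closedBall 0 r :=
  hC.isBounded.subset_closedBall 0

theorem exists_volume_real_shadow_rot_le {C : Set (EuclideanSpace ℝ (Fin n))} (hC : IsCompact C)
    (H : Submodule ℝ (EuclideanSpace ℝ (Fin n))) :
    ∃ M : ℝ, ∀ g, volume.real (shadow (rot g '' C) H) ≤ M := by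
  obtain ⟨r, hr⟩ := exists_subset_closedBall hC
  refine ⟨volume.real (shadow (Metric.closedBall 0 r) H), fun g => ?_⟩
  refine volume_real_shadow_mono ?_ (isCompact_closedBall _ _) H
  rw [← image_rot_closedBall g r]
  exact Set.image_mono hr

theorem integrable_volume_shadow_rot {C : Set (EuclideanSpace ℝ (Fin n))} (hC : IsCompact C)
    (H : Submodule ℝ (EuclideanSpace ℝ (Fin n))) :
    Integrable (fun g => volume.real (shadow (rot g⁻¹ '' C) H)) (haarO n) := by
  obtain ⟨M, hM⟩ := exists_volume_real_shadow_rot_le hC H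
  refine Integrable.of_bound
    (measurable_volume_shadow_rot hC H).ennreal_toReal.aestronglyMeasurable M ?_
  exact Filter.Eventually.of_forall fun g => by
    rw [Real.norm_of_nonneg measureReal_nonneg]; exact hM _

theorem volume_real_shadow_rotateGr (H : Gr n j) (g : Matrix.orthogonalGroup (Fin n) ℝ)
    (C : Set (EuclideanSpace ℝ (Fin n))) :
    volume.real (shadow C (rotateGr H g).1) = volume.real (shadow (rot g⁻¹ '' C) H.1) := by
  simp only [Measure.real, volume_shadow_rotateGr]

theorem grMeasure_eq (h : j ≤ n) : grMeasure n j = (haarO n).map (rotateGr (coordGr h)) := by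
  rw [grMeasure, dif_pos h]

instance isFiniteMeasure_grMeasure (n j : ℕ) : IsFiniteMeasure (grMeasure n j) := by
  by_cases h : j ≤ n
  · rw [grMeasure_eq h]; infer_instance
  · rw [grMeasure, dif_neg h]; infer_instance

theorem integrable_volume_shadow {C : Set (EuclideanSpace ℝ (Fin n))} (hC : IsCompact C) :
    Integrable (fun H : Gr n j => volume.real (shadow C H.1)) (grMeasure n j) := by
  by_cases h : j ≤ n
  · rw [grMeasure_eq h, integrable_map_measure
      (measurable_volume_real_shadow hC).aestronglyMeasurable
      (continuous_rotateGr _).measurable.aemeasurable]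
    simpa only [Function.comp_def, volume_real_shadow_rotateGr] using
      integrable_volume_shadow_rot hC _
  · rw [grMeasure, dif_neg h]
    exact integrable_zero_measure

/-- The mean volume of the shadows of `C` on `j`-dimensional subspaces. -/
noncomputable def meanShadow (j : ℕ) (C : Set (EuclideanSpace ℝ (Fin n))) : ℝ :=
  ∫ H : Gr n j, volume.real (shadow C H.1) ∂(grMeasure n j)

/-- Rotating the body replaces rotating the subspace. Writing `H` as a rotate `g₀ H₀` of the
coordinate subspace, right invariance absorbs `g₀`, so only the dimension of `H` matters. -/
theorem integral_volume_shadow_rot {C : Set (EuclideanSpace ℝ (Fin n))} (hC : IsCompact C)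
    (H : Submodule ℝ (EuclideanSpace ℝ (Fin n))) :
    ∫ g, volume.real (shadow (rot g⁻¹ '' C) H) ∂(haarO n) =
      meanShadow (Module.finrank ℝ H) C := by
  have hj : Module.finrank ℝ H ≤ n := by
    simpa using Submodule.finrank_le H
  obtain ⟨g₀, hg₀⟩ := exists_rotateGr_eq (coordGr hj) ⟨H, rfl⟩
  have h1 : ∀ g, volume.real (shadow (rot g⁻¹ '' C) H) =
      volume.real (shadow C (rotateGr (coordGr hj) (g * g₀)).1) := by
    intro g
    rw [rotateGr_mul, hg₀, volume_real_shadow_rotateGr]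
  simp only [h1]
  rw [integral_mul_right_eq_self
    (fun g => volume.real (shadow C (rotateGr (coordGr hj) g).1)) g₀, meanShadow,
    grMeasure_eq hj, integral_map (continuous_rotateGr _).measurable.aemeasurable
      (measurable_volume_real_shadow hC).aestronglyMeasurable]

end Grassmannian

/-! ### Adding a segment to a convex body -/

section Segment

theorem volume_add_Icc_zero {S : Set ℝ} (hc : IsCompact S) (hS : Convex ℝ S) (hne : S.Nonempty)
    {t : ℝ} (ht : 0 ≤ t) :
    volume {x : ℝ | ∃ r ∈ Set.Icc 0 t, x - r ∈ S} = volume S + ENNReal.ofReal t := by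
  have hS' : S = Set.Icc (sInf S) (sSup S) :=
    eq_Icc_of_connected_compact ⟨hne, hS.isPreconnected⟩ hc
  have hle : sInf S ≤ sSup S := Real.sInf_le_sSup _ hc.bddBelow hc.bddAbove
  generalize sInf S = a at *
  generalize sSup S = b at *
  subst hS'
  have h : {x : ℝ | ∃ r ∈ Set.Icc 0 t, x - r ∈ Set.Icc a b} = Set.Icc a (b + t) := by
    ext x
    simp only [Set.mem_ofPred_eq, Set.mem_Icc]
    constructor
    · rintro ⟨r, ⟨h1, h2⟩, h3, h4⟩
      constructor <;> linarith
    · rintro ⟨h1, h2⟩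
      rcases le_total x b with hb | hb
      · exact ⟨0, ⟨le_rfl, ht⟩, by linarith, by linarith⟩
      · exact ⟨x - b, ⟨by linarith, by linarith⟩, by linarith, by linarith⟩
  rw [h, Real.volume_Icc, Real.volume_Icc, ← ENNReal.ofReal_add (by linarith) ht]
  congr 1
  ring

/-- Fubini: by convexity each nonempty fibre over `G` is an interval, which is lengthened by exactly
`t`, and the nonempty fibres lie over the projection of `D`. -/
theorem prod_volume_add_Icc_zero {G : Type*} [NormedAddCommGroup G] [NormedSpace ℝ G]
    [FiniteDimensional ℝ G] [MeasurableSpace G] [BorelSpace G] (μ : Measure G) [SFinite μ]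
    {D : Set (G × ℝ)} (hc : IsCompact D) (hD : Convex ℝ D) {t : ℝ} (ht : 0 ≤ t) :
    (μ.prod volume) {p : G × ℝ | ∃ r ∈ Set.Icc 0 t, (p.1, p.2 - r) ∈ D} =
      (μ.prod volume) D + ENNReal.ofReal t * μ (Prod.fst '' D) := by
  have hE : IsClosed {p : G × ℝ | ∃ r ∈ Set.Icc 0 t, (p.1, p.2 - r) ∈ D} := by
    have : {p : G × ℝ | ∃ r ∈ Set.Icc 0 t, (p.1, p.2 - r) ∈ D} =
        (fun q : (G × ℝ) × ℝ => (q.1.1, q.1.2 + q.2)) '' (D ×ˢ Set.Icc 0 t) := by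
      ext ⟨z, x⟩
      simp only [Set.mem_ofPred_eq, Set.mem_image, Set.mem_prod, Prod.mk.injEq, Prod.exists]
      constructor
      · rintro ⟨r, hr, h⟩
        exact ⟨z, x - r, r, ⟨h, hr⟩, rfl, by ring⟩
      · rintro ⟨z', x', r, ⟨h, hr⟩, rfl, rfl⟩
        exact ⟨r, hr, by simpa using h⟩
    rw [this]
    exact ((hc.prod isCompact_Icc).image (by fun_prop)).isClosed
  have hfst : MeasurableSet (Prod.fst '' D) := (hc.image continuous_fst).isClosed.measurableSet
  rw [Measure.prod_apply hE.measurableSet, Measure.prod_apply hc.isClosed.measurableSet,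
    ← lintegral_indicator_const hfst, ← lintegral_add_left
      (measurable_measure_prodMk_left hc.isClosed.measurableSet)]
  refine lintegral_congr fun z => ?_
  have hslice : Convex ℝ (Prod.mk z ⁻¹' D) := by
    intro x hx y hy a b ha hb hab
    have h := hD hx hy ha hb hab
    have h2 : a • (z, x) + b • (z, y) = (z, a • x + b • y) := by
      simp only [Prod.smul_mk, Prod.mk_add_mk, ← add_smul, hab, one_smul]
    rwa [h2] at h
  have hsc : IsCompact (Prod.mk z ⁻¹' D) := by
    have : Topology.IsClosedEmbedding (Prod.mk z : ℝ → G × ℝ) :=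
      .of_continuous_injective_isClosedMap (by fun_prop) (Prod.mk_right_injective z)
        fun s hs => by
          have : Prod.mk z '' s = {z} ×ˢ s := by simp [Set.singleton_prod]
          rw [this]
          exact isClosed_singleton.prod hs
    exact this.isCompact_preimage hc
  by_cases hz : z ∈ Prod.fst '' D
  · have hne : (Prod.mk z ⁻¹' D).Nonempty := by
      obtain ⟨⟨z', x⟩, hx, rfl⟩ := hz
      exact ⟨x, hx⟩
    rw [Set.indicator_of_mem hz, ← volume_add_Icc_zero hsc hslice hne ht]
    rfl
  · have he : Prod.mk z ⁻¹' D = ∅ := by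
      refine Set.eq_empty_of_forall_notMem fun x hx => hz ⟨(z, x), hx, rfl⟩
    have he2 : Prod.mk z ⁻¹' {p : G × ℝ | ∃ r ∈ Set.Icc 0 t, (p.1, p.2 - r) ∈ D} = ∅ := by
      refine Set.eq_empty_of_forall_notMem ?_
      rintro x ⟨r, -, hx⟩
      exact hz ⟨_, hx, rfl⟩
    rw [Set.indicator_of_notMem hz, he, he2, measure_empty, add_zero]

variable {n : ℕ} {H H' : Submodule ℝ (EuclideanSpace ℝ (Fin n))} {u : EuclideanSpace ℝ (Fin n)}

theorem starProjection_eq_add_of_hyperplane (hu : ‖u‖ = 1) (huH : u ∈ H)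
    (hH' : ∀ x, x ∈ H' ↔ x ∈ H ∧ inner ℝ u x = 0) (x : EuclideanSpace ℝ (Fin n)) :
    H.starProjection x = H'.starProjection x + inner ℝ u x • u := by
  have huu : inner ℝ u u = (1 : ℝ) := by rw [real_inner_self_eq_norm_sq, hu]; norm_num
  apply Submodule.eq_starProjection_of_mem_of_inner_eq_zero
  · exact H.add_mem ((hH' _).1 (H'.starProjection_apply_mem x)).1 (H.smul_mem _ huH)
  · intro w hw
    have hw' : w - inner ℝ u w • u ∈ H' := by
      refine (hH' _).2 ⟨H.sub_mem hw (H.smul_mem _ huH), ?_⟩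
      rw [inner_sub_right, inner_smul_right, huu]
      ring
    have h1 : inner ℝ (x - H'.starProjection x) (w - inner ℝ u w • u) = (0 : ℝ) :=
      H'.starProjection_inner_eq_zero x _ hw'
    have h2 : inner ℝ (H'.starProjection x) u = (0 : ℝ) := by
      rw [real_inner_comm]; exact ((hH' _).1 (H'.starProjection_apply_mem x)).2
    simp only [inner_sub_left, inner_sub_right, inner_add_left, inner_smul_left,
      inner_smul_right, h2, RCLike.conj_to_real] at h1 ⊢
    rw [real_inner_comm x u]
    linarith

/-- Splitting a subspace orthogonally along a unit vector. -/
noncomputable def hyperplaneSplit (hu : ‖u‖ = 1) (huH : u ∈ H)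
    (hH' : ∀ x, x ∈ H' ↔ x ∈ H ∧ inner ℝ u x = 0) : H ≃ₗᵢ[ℝ] WithLp 2 (H' × ℝ) where
  toFun x := WithLp.toLp 2 (H'.orthogonalProjectionOnto x, inner ℝ u (x : EuclideanSpace ℝ (Fin n)))
  map_add' x y := by
    rw [← WithLp.toLp_add]
    simp [inner_add_right]
  map_smul' c x := by
    rw [RingHom.id_apply, ← WithLp.toLp_smul]
    simp [inner_smul_right]
  invFun p := ⟨(p.fst : EuclideanSpace ℝ (Fin n)) + p.snd • u,
    H.add_mem ((hH' _).1 p.fst.2).1 (H.smul_mem _ huH)⟩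
  left_inv x := by
    apply Subtype.ext
    have h := starProjection_eq_add_of_hyperplane hu huH hH' (x : EuclideanSpace ℝ (Fin n))
    rw [Submodule.starProjection_eq_self_iff.2 x.2] at h
    exact h.symm
  right_inv p := by
    have huu : inner ℝ u u = (1 : ℝ) := by rw [real_inner_self_eq_norm_sq, hu]; norm_num
    have h0 : inner ℝ u (p.fst : EuclideanSpace ℝ (Fin n)) = (0 : ℝ) := ((hH' _).1 p.fst.2).2
    have h1 : H'.orthogonalProjectionOnto u = 0 := by
      rw [Submodule.orthogonalProjectionOnto_eq_zero_iff, Submodule.mem_orthogonal']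
      exact fun w hw => ((hH' _).1 hw).2
    apply WithLp.ofLp_injective 2
    simp [inner_add_right, inner_smul_right, hu, h0, h1]
    rfl
  norm_map' x := by
    have h := starProjection_eq_add_of_hyperplane hu huH hH' (x : EuclideanSpace ℝ (Fin n))
    rw [Submodule.starProjection_eq_self_iff.2 x.2] at h
    have h2 : inner ℝ (H'.starProjection (x : EuclideanSpace ℝ (Fin n)))
        (inner ℝ u (x : EuclideanSpace ℝ (Fin n)) • u) = (0 : ℝ) := by
      rw [inner_smul_right, real_inner_comm u,
        ((hH' _).1 (H'.starProjection_apply_mem _)).2, mul_zero]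
    have h3 := norm_add_sq_eq_norm_sq_add_norm_sq_of_inner_eq_zero _ _ h2
    rw [← h, norm_smul, hu, mul_one, ← sq, ← sq, ← sq] at h3
    exact (sq_eq_sq₀ (norm_nonneg _) (norm_nonneg _)).1
      ((WithLp.prod_norm_sq_eq_of_L2 _).trans h3.symm)

/-- The orthogonal splitting of `H` along `u` is isometric for the `L²` product norm, hence carries
`volume` to the product measure needed for Fubini. -/
theorem volume_shadow_eq_prod (hu : ‖u‖ = 1) (huH : u ∈ H)
    (hH' : ∀ x, x ∈ H' ↔ x ∈ H ∧ inner ℝ u x = 0) (C : Set (EuclideanSpace ℝ (Fin n))) :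
    volume (shadow C H) = ((volume : Measure H').prod (volume : Measure ℝ))
      ((fun x => (H'.orthogonalProjectionOnto x, inner ℝ u x)) '' C) := by
  set Φ := hyperplaneSplit hu huH hH'
  have h1 := Φ.measurePreserving.measure_preimage_equiv (f := Φ.toMeasurableEquiv)
    (Φ '' shadow C H)
  have h1' : volume (shadow C H) = volume (Φ '' shadow C H) := by
    rw [← h1]
    congr 1
    exact (Φ.injective.preimage_image _).symm
  have h2 := (WithLp.volume_preserving_symm_measurableEquiv_toLp_prod H' ℝ).measure_preimage_equiv
    ((fun x => (H'.orthogonalProjectionOnto x, inner ℝ u x)) '' C)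
  rw [h1', ← Measure.volume_eq_prod, ← h2]
  congr 1
  have h3 : ∀ x, Φ (H.orthogonalProjectionOnto x) =
      WithLp.toLp 2 (H'.orthogonalProjectionOnto x, inner ℝ u x) := by
    intro x
    have hx : inner ℝ u (H.orthogonalProjectionOnto x : EuclideanSpace ℝ (Fin n)) =
        inner ℝ u x := H.inner_orthogonalProjectionOnto_eq_of_mem_left ⟨u, huH⟩ x
    have hx2 : H'.orthogonalProjectionOnto (H.orthogonalProjectionOnto x :
        EuclideanSpace ℝ (Fin n)) = H'.orthogonalProjectionOnto x :=
      Submodule.orthogonalProjectionOnto_starProjection_of_le (fun y hy => ((hH' y).1 hy).1) x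
    change WithLp.toLp 2 (_, _) = _
    rw [hx, hx2]
  rw [shadow, Set.image_image]
  simp only [h3]
  rw [← MeasurableEquiv.image_eq_preimage_symm, Set.image_image]
  rfl

theorem volume_shadow_add_segment_of_unit (hu : ‖u‖ = 1) (huH : u ∈ H)
    (hH' : ∀ x, x ∈ H' ↔ x ∈ H ∧ inner ℝ u x = 0) {C : Set (EuclideanSpace ℝ (Fin n))}
    (hC : IsCompact C) (hconv : Convex ℝ C) {t : ℝ} (ht : 0 ≤ t) {s : EuclideanSpace ℝ (Fin n)}
    (hs : H.starProjection s = t • u) :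
    volume (shadow (C + segment ℝ 0 s) H) =
      volume (shadow C H) + ENNReal.ofReal t * volume (shadow C H') := by
  have hs0 : H'.orthogonalProjectionOnto s = 0 := by
    rw [Submodule.orthogonalProjectionOnto_eq_zero_iff, Submodule.mem_orthogonal']
    intro w hw
    have h := (hH' w).1 hw
    have h2 := H.inner_orthogonalProjectionOnto_eq_of_mem_right ⟨w, h.1⟩ s
    have h3 : inner ℝ (H.starProjection s) w = inner ℝ s w := h2
    rw [← h3, hs, inner_smul_left, h.2, mul_zero]
  have hsu : inner ℝ u s = t := by
    have h2 : inner ℝ u (H.starProjection s) = inner ℝ u s :=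
      H.inner_orthogonalProjectionOnto_eq_of_mem_left ⟨u, huH⟩ s
    rw [← h2, hs, inner_smul_right, real_inner_self_eq_norm_sq, hu]
    ring
  rw [volume_shadow_eq_prod hu huH hH', volume_shadow_eq_prod hu huH hH' C]
  let T : EuclideanSpace ℝ (Fin n) →L[ℝ] H' × ℝ :=
    H'.orthogonalProjectionOnto.prod (innerSL ℝ u)
  have hTC : IsCompact (T '' C) := hC.image T.continuous
  have h := prod_volume_add_Icc_zero (volume : Measure H') hTC
    (hconv.linear_image T.toLinearMap) ht
  have e1 : Prod.fst '' (T '' C) = shadow C H' := by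
    rw [Set.image_image]; rfl
  have e2 : {p : H' × ℝ | ∃ r ∈ Set.Icc 0 t, (p.1, p.2 - r) ∈ T '' C} =
      T '' (C + segment ℝ 0 s) := by
    have hT : ∀ (x : EuclideanSpace ℝ (Fin n)) (c : ℝ),
        T (x + c • s) = (H'.orthogonalProjectionOnto x, inner ℝ u x + c * t) := by
      intro x c
      simp [T, hs0, inner_add_right, inner_smul_right, hsu]
    ext ⟨z, y⟩
    constructor
    · rintro ⟨r, hr, x, hx, hxy⟩
      obtain ⟨c, hc, hct⟩ : ∃ c ∈ Set.Icc (0 : ℝ) 1, c * t = r := by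
        rcases ht.eq_or_lt with rfl | ht
        · exact ⟨0, ⟨le_rfl, zero_le_one⟩, by linarith [hr.1, hr.2]⟩
        · exact ⟨r / t, ⟨div_nonneg hr.1 ht.le, div_le_one_of_le₀ hr.2 ht.le⟩,
            div_mul_cancel₀ r ht.ne'⟩
      refine ⟨x + c • s, Set.add_mem_add hx ?_, ?_⟩
      · rw [segment_eq_image']
        exact ⟨c, hc, by simp⟩
      · rw [hT, hct]
        have h1 := congrArg Prod.fst hxy
        have h2 := congrArg Prod.snd hxy
        refine Prod.ext h1 ?_
        have h3 : inner ℝ u x = y - r := h2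
        simp [h3]
    · rintro ⟨w, ⟨x, hx, v, hv, rfl⟩, hw⟩
      rw [segment_eq_image'] at hv
      obtain ⟨c, hc, rfl⟩ := hv
      have hw' : T (x + c • s) = (z, y) := by simpa using hw
      rw [hT, Prod.mk.injEq] at hw'
      refine ⟨c * t, ⟨mul_nonneg hc.1 ht, mul_le_of_le_one_left ht hc.2⟩, x, hx, ?_⟩
      refine Prod.ext hw'.1 ?_
      change inner ℝ u x = y - c * t
      linarith [hw'.2]
  rw [e1, e2] at h
  exact h

theorem volume_shadow_add_segment (H : Submodule ℝ (EuclideanSpace ℝ (Fin n)))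
    {C : Set (EuclideanSpace ℝ (Fin n))}
    (hC : IsCompact C) (hconv : Convex ℝ C) (s : EuclideanSpace ℝ (Fin n)) :
    volume.real (shadow (C + segment ℝ 0 s) H) = volume.real (shadow C H) +
      ‖H.starProjection s‖ * volume.real (shadow C (H ⊓ (Submodule.span ℝ {s})ᗮ : Submodule ℝ _)) := by
  set H' : Submodule ℝ (EuclideanSpace ℝ (Fin n)) := H ⊓ (Submodule.span ℝ {s})ᗮ with hH'
  by_cases h0 : H.starProjection s = 0
  · have h1 : H.orthogonalProjectionOnto s = 0 := Subtype.ext h0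
    have h2 : shadow (C + segment ℝ 0 s) H = shadow C H := by
      rw [shadow, shadow, Set.image_add, segment_eq_image', Set.image_image]
      simp only [map_add, map_smul, sub_zero, h1, map_zero, smul_zero, add_zero]
      rw [(Set.nonempty_Icc.2 zero_le_one).image_const]
      simp
    rw [h2, h0, norm_zero, zero_mul, add_zero]
  · set t := ‖H.starProjection s‖ with ht
    have ht0 : t ≠ 0 := norm_ne_zero_iff.2 h0
    set u := t⁻¹ • H.starProjection s with hu
    have hu1 : ‖u‖ = 1 := by
      rw [hu, norm_smul, norm_inv, ht, norm_norm, inv_mul_cancel₀ ht0]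
    have huH : u ∈ H := H.smul_mem _ (H.starProjection_apply_mem s)
    have htu : H.starProjection s = t • u := by rw [hu, smul_inv_smul₀ ht0]
    have hmem : ∀ x, x ∈ H' ↔ x ∈ H ∧ inner ℝ u x = 0 := by
      intro x
      rw [hH', Submodule.mem_inf, Submodule.mem_orthogonal_singleton_iff_inner_right]
      -- Vectors of `H` have the same inner product with `s` as with its projection, so within `H`
      -- the conditions of being orthogonal to `s` and to `u` agree.
      refine and_congr_right fun hx => ?_
      have h3 : inner ℝ (H.starProjection s) x = inner ℝ s x :=
        H.inner_orthogonalProjectionOnto_eq_of_mem_right ⟨x, hx⟩ s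
      rw [← h3, htu, inner_smul_left]
      simp [ht0]
    have h := volume_shadow_add_segment_of_unit hu1 huH hmem hC hconv (norm_nonneg _) htu
    simp only [Measure.real]
    rw [h, ENNReal.toReal_add (isCompact_shadow hC H).measure_lt_top.ne
      (ENNReal.mul_ne_top ENNReal.ofReal_ne_top (isCompact_shadow hC H').measure_lt_top.ne),
      ENNReal.toReal_mul, ENNReal.toReal_ofReal (norm_nonneg _)]

end Segment

/-! ### Zonotopes -/

section Zonotope

variable {n : ℕ}

/-- The Minkowski sum of the segments `[0, s]`, for `s` in a list. -/
noncomputable def zonotope : List (EuclideanSpace ℝ (Fin n)) → Set (EuclideanSpace ℝ (Fin n))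
  | [] => {0}
  | s :: l => segment ℝ 0 s + zonotope l

theorem isCompact_segment_zero (s : EuclideanSpace ℝ (Fin n)) : IsCompact (segment ℝ 0 s) := by
  rw [segment_eq_image']
  exact isCompact_Icc.image (by fun_prop)

theorem isCompact_zonotope : ∀ l : List (EuclideanSpace ℝ (Fin n)), IsCompact (zonotope l)
  | [] => isCompact_singleton
  | s :: l => (isCompact_segment_zero s).add (isCompact_zonotope l)

theorem convex_zonotope : ∀ l : List (EuclideanSpace ℝ (Fin n)), Convex ℝ (zonotope l)
  | [] => convex_singleton _
  | _ :: l => (convex_segment _ _).add (convex_zonotope l)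

/-- Each segment splits the `H`-term into terms for `H` and `H ⊓ s^⊥`, so the induction runs over
all subspaces at once. Only `C` is rotated, which leaves the coefficients independent of `C`; their
nonnegativity is what later allows them to be bounded. -/
theorem exists_coeff_integral_volume_add_zonotope (l : List (EuclideanSpace ℝ (Fin n)))
    (H : Submodule ℝ (EuclideanSpace ℝ (Fin n))) :
    ∃ a : ℕ → ℝ, (∀ k, 0 ≤ a k) ∧ ∀ C : Set (EuclideanSpace ℝ (Fin n)), IsCompact C →
      Convex ℝ C →
      Integrable (fun g => volume.real (shadow (rot g⁻¹ '' C + zonotope l) H)) (haarO n) ∧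
      ∫ g, volume.real (shadow (rot g⁻¹ '' C + zonotope l) H) ∂(haarO n) =
        ∑ k ∈ Finset.range (n + 1), a k * meanShadow k C := by
  induction l generalizing H with
  | nil =>
    refine ⟨fun k => if k = Module.finrank ℝ H then 1 else 0, fun k => by positivity,
      fun C hC _ => ?_⟩
    have hj : Module.finrank ℝ H ≤ n := by simpa using Submodule.finrank_le H
    simp only [zonotope, Set.add_singleton, add_zero, Set.image_id']
    refine ⟨integrable_volume_shadow_rot hC H, ?_⟩
    rw [integral_volume_shadow_rot hC H]
    simp [Nat.lt_succ_of_le hj]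
  | cons s l ih =>
    obtain ⟨a, ha0, ha⟩ := ih H
    obtain ⟨b, hb0, hb⟩ := ih (H ⊓ (Submodule.span ℝ {s})ᗮ)
    refine ⟨fun k => a k + ‖H.starProjection s‖ * b k,
      fun k => add_nonneg (ha0 k) (mul_nonneg (norm_nonneg _) (hb0 k)), fun C hC hconv => ?_⟩
    have h : ∀ g : Matrix.orthogonalGroup (Fin n) ℝ,
        volume.real (shadow (rot g⁻¹ '' C + zonotope (s :: l)) H) =
        volume.real (shadow (rot g⁻¹ '' C + zonotope l) H) + ‖H.starProjection s‖ *
          volume.real (shadow (rot g⁻¹ '' C + zonotope l)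
            (H ⊓ (Submodule.span ℝ {s})ᗮ : Submodule ℝ _)) := by
      intro g
      rw [zonotope, add_comm (segment ℝ 0 s), ← add_assoc]
      refine volume_shadow_add_segment H ?_ ?_ s
      · exact (hC.image (rot g⁻¹).continuous).add (isCompact_zonotope l)
      · exact (hconv.linear_image (rot g⁻¹).toLinearEquiv.toLinearMap).add (convex_zonotope l)
    simp only [h]
    have h1 := ha C hC hconv
    have h2 := hb C hC hconv
    refine ⟨h1.1.add (h2.1.const_mul _), ?_⟩
    rw [integral_add h1.1 (h2.1.const_mul _), integral_const_mul, h1.2, h2.2, Finset.mul_sum,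
      ← Finset.sum_add_distrib]
    exact Finset.sum_congr rfl fun k _ => by ring

end Zonotope

/-! ### Approximating the ball by zonotopes -/

section BallApproximation

variable {n : ℕ}

/-- The reflection in the hyperplane orthogonal to `v - w` exchanges the two vectors. -/
theorem exists_rot_apply_eq {v w : EuclideanSpace ℝ (Fin n)} (h : ‖v‖ = ‖w‖) :
    ∃ g : Matrix.orthogonalGroup (Fin n) ℝ, rot g v = w := by
  obtain ⟨g, hg⟩ := exists_rot_eq (Submodule.reflection (Submodule.span ℝ {v - w})ᗮ)
  exact ⟨g, by rw [hg, Submodule.reflection_sub h]⟩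

/-- Doubling the generators and translating by `-l.sum` turns the segments `[0, 2s]` into the
symmetric ones `[-s, s]`. This bound and its attainment in the next lemma say that the support
function of the result is `∑ |⟪s, v⟫|`. -/
theorem inner_sub_sum_le_of_mem_zonotope (v : EuclideanSpace ℝ (Fin n)) :
    ∀ (l : List (EuclideanSpace ℝ (Fin n))), ∀ z ∈ zonotope (l.map ((2 : ℝ) • ·)),
      inner ℝ (z - l.sum) v ≤ (l.map fun s => |inner ℝ s v|).sum := by
  intro l
  induction l with
  | nil =>
    intro z hz
    have : z = 0 := hz
    simp [this]
  | cons s l ih =>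
    rintro z ⟨x, hx, y, hy, rfl⟩
    rw [segment_eq_image'] at hx
    obtain ⟨t, ht, rfl⟩ := hx
    have h1 := ih y hy
    have h2 : inner ℝ ((0 : EuclideanSpace ℝ (Fin n)) + t • ((2 : ℝ) • s - 0) + y -
        (s :: l).sum) v = (2 * t - 1) * inner ℝ s v + inner ℝ (y - l.sum) v := by
      simp only [zero_add, sub_zero, List.sum_cons, inner_sub_left, inner_add_left,
        inner_smul_left, RCLike.conj_to_real]
      ring
    have h3 : (2 * t - 1) * inner ℝ s v ≤ |inner ℝ s v| := by
      refine (le_abs_self _).trans ?_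
      rw [abs_mul]
      exact mul_le_of_le_one_left (abs_nonneg _)
        (abs_le.2 ⟨by linarith [ht.1], by linarith [ht.2]⟩)
    simp only [List.map_cons, List.sum_cons]
    refine le_trans (le_of_eq ?_) (add_le_add h3 h1)
    exact h2

theorem exists_mem_zonotope_inner_sub_sum_eq (v : EuclideanSpace ℝ (Fin n)) :
    ∀ (l : List (EuclideanSpace ℝ (Fin n))), ∃ z ∈ zonotope (l.map ((2 : ℝ) • ·)),
      inner ℝ (z - l.sum) v = (l.map fun s => |inner ℝ s v|).sum := by
  intro l
  induction l with
  | nil => exact ⟨0, rfl, by simp⟩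
  | cons s l ih =>
    obtain ⟨y, hy, hyl⟩ := ih
    obtain ⟨x, hx, hxs⟩ : ∃ x ∈ segment ℝ 0 ((2 : ℝ) • s),
        inner ℝ (x - s) v = |inner ℝ s v| := by
      rcases le_total 0 (inner ℝ s v) with h | h
      · refine ⟨_, right_mem_segment ℝ _ _, ?_⟩
        rw [abs_of_nonneg h, two_smul, add_sub_cancel_right]
      · refine ⟨_, left_mem_segment ℝ _ _, ?_⟩
        rw [abs_of_nonpos h, zero_sub, inner_neg_left]
    refine ⟨x + y, Set.add_mem_add hx hy, ?_⟩
    simp only [List.map_cons, List.sum_cons]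
    rw [← hxs, ← hyl, ← inner_add_left]
    congr 1
    abel

/-- Support functions decide inclusion: a point of the ball outside the zonotope would be separated
from it by some `w`, contradicting the lower bound; the upper bound is tested on the direction of `z
- l.sum` itself. The vector `0` has no direction and no sign of `η` is assumed, whence the
alternative. -/
theorem zonotope_near_ball {l : List (EuclideanSpace ℝ (Fin n))} {η : ℝ}
    (h : ∀ v : EuclideanSpace ℝ (Fin n), ‖v‖ = 1 →
      1 ≤ (l.map fun s => |inner ℝ s v|).sum ∧ (l.map fun s => |inner ℝ s v|).sum ≤ 1 + η) :
    (∀ x ∈ Metric.closedBall (0 : EuclideanSpace ℝ (Fin n)) 1,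
      x + l.sum ∈ zonotope (l.map ((2 : ℝ) • ·))) ∧
    ∀ z ∈ zonotope (l.map ((2 : ℝ) • ·)), z - l.sum = 0 ∨ ‖z - l.sum‖ ≤ 1 + η := by
  constructor
  · intro x hx
    by_contra hxz
    obtain ⟨f, r, hf1, hf2⟩ := geometric_hahn_banach_closed_point
      (convex_zonotope (l.map ((2 : ℝ) • ·))) (isCompact_zonotope _).isClosed hxz
    obtain ⟨w, rfl⟩ := (InnerProductSpace.toDual ℝ (EuclideanSpace ℝ (Fin n))).surjective f
    simp only [InnerProductSpace.toDual_apply_apply] at hf1 hf2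
    have hw0 : w ≠ 0 := by
      rintro rfl
      obtain ⟨z, hz, -⟩ := exists_mem_zonotope_inner_sub_sum_eq 0 l
      have := hf1 z hz
      simp only [inner_zero_left] at this hf2
      linarith
    have hwn : ‖w‖ ≠ 0 := norm_ne_zero_iff.2 hw0
    obtain ⟨z, hz, hzw⟩ := exists_mem_zonotope_inner_sub_sum_eq (‖w‖⁻¹ • w) l
    have h1 := (h (‖w‖⁻¹ • w) (by rw [norm_smul, norm_inv, norm_norm, inv_mul_cancel₀ hwn])).1
    rw [← hzw, inner_smul_right] at h1
    have h2 : ‖w‖ ≤ inner ℝ (z - l.sum) w := by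
      have := mul_le_mul_of_nonneg_left h1 (norm_nonneg w)
      rwa [mul_one, mul_inv_cancel_left₀ hwn] at this
    have h3 : inner ℝ w x ≤ ‖w‖ := by
      refine (real_inner_le_norm w x).trans (mul_le_of_le_one_right (norm_nonneg _) ?_)
      simpa using hx
    have h4 := hf1 z hz
    rw [inner_add_right] at hf2
    rw [inner_sub_left, real_inner_comm w z, real_inner_comm w l.sum] at h2
    linarith
  · intro z hz
    by_cases h0 : z - l.sum = 0
    · exact Or.inl h0
    right
    set w := z - l.sum with hw
    have hwn : ‖w‖ ≠ 0 := norm_ne_zero_iff.2 h0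
    have h1 := (h (‖w‖⁻¹ • w) (by rw [norm_smul, norm_inv, norm_norm, inv_mul_cancel₀ hwn])).2
    have h2 := inner_sub_sum_le_of_mem_zonotope (‖w‖⁻¹ • w) l z hz
    rw [← hw, inner_smul_right, real_inner_self_eq_norm_sq, sq, inv_mul_cancel_left₀ hwn] at h2
    exact h2.trans h1

/-- The function `v ↦ |⟪g e, v⟫|` on the unit sphere. -/
noncomputable def absInnerRot (e : EuclideanSpace ℝ (Fin n)) :
    C(Matrix.orthogonalGroup (Fin n) ℝ,
      C(Metric.sphere (0 : EuclideanSpace ℝ (Fin n)) 1, ℝ)) :=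
  ContinuousMap.curry ⟨fun p => |inner ℝ (rot p.1 e) (p.2 : EuclideanSpace ℝ (Fin n))|, by
    have h : Continuous fun p : Matrix.orthogonalGroup (Fin n) ℝ ×
        Metric.sphere (0 : EuclideanSpace ℝ (Fin n)) 1 => rot p.1 e :=
      continuous_fst.rot_apply continuous_const
    exact (h.inner (continuous_subtype_val.comp continuous_snd)).abs⟩

theorem absInnerRot_apply (e : EuclideanSpace ℝ (Fin n)) (g : Matrix.orthogonalGroup (Fin n) ℝ)
    (v : Metric.sphere (0 : EuclideanSpace ℝ (Fin n)) 1) :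
    absInnerRot e g v = |inner ℝ (rot g e) (v : EuclideanSpace ℝ (Fin n))| := rfl

theorem integrable_of_continuous_haarO {X : Type*} [NormedAddCommGroup X]
    {f : Matrix.orthogonalGroup (Fin n) ℝ → X} (hf : Continuous f) : Integrable f (haarO n) :=
  hf.integrable_of_hasCompactSupport (HasCompactSupport.of_compactSpace f)

/-- Left invariance and transitivity on the sphere make the mean independent of `v`; it is positive
because the integrand at `v = e` is continuous and equals `1` at the identity. -/
theorem exists_integral_absInnerRot_eq {e : EuclideanSpace ℝ (Fin n)} (he : ‖e‖ = 1) :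
    ∃ c : ℝ, 0 < c ∧ ∀ v, (∫ g, absInnerRot e g ∂(haarO n)) v = c := by
  have hint : ∀ v, (∫ g, absInnerRot e g ∂(haarO n)) v =
      ∫ g, |inner ℝ (rot g e) (v : EuclideanSpace ℝ (Fin n))| ∂(haarO n) := by
    intro v
    have hi : Integrable (fun g => absInnerRot e g) (haarO n) :=
      integrable_of_continuous_haarO (absInnerRot e).continuous
    exact ((ContinuousMap.evalCLM ℝ v).integral_comp_comm hi).symm
  refine ⟨∫ g, |inner ℝ (rot g e) e| ∂(haarO n), ?_, fun v => ?_⟩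
  · have hc : Continuous fun g : Matrix.orthogonalGroup (Fin n) ℝ => |inner ℝ (rot g e) e| :=
      ((continuous_id.rot_apply continuous_const).inner continuous_const).abs
    refine hc.integral_pos_of_hasCompactSupport_nonneg_nonzero
      (HasCompactSupport.of_compactSpace _) (fun g => abs_nonneg _) (x := 1) ?_
    rw [rot_one_apply, real_inner_self_eq_norm_sq, he]
    norm_num
  · obtain ⟨h, hh⟩ := exists_rot_apply_eq (v := e) (w := v) (by
      rw [he, norm_eq_of_mem_sphere])
    rw [hint, ← integral_mul_left_eq_self _ h]
    simp only [rot_mul_apply]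
    rw [← hh]
    simp only [LinearIsometryEquiv.inner_map_map]

/-- The constant `c` is an average of the functions `v ↦ |⟪g e, v⟫|`, hence lies in the uniform
closure of the convex set `W` of finite sums `∑ |⟪s, v⟫|`. Nonnegative factors can be moved into the
vectors `s`, which gives both the convexity of `W` and the final rescaling. -/
theorem exists_list_abs_inner_near_one (hn : 1 ≤ n) {η : ℝ} (hη : 0 < η) :
    ∃ l : List (EuclideanSpace ℝ (Fin n)), ∀ v : EuclideanSpace ℝ (Fin n), ‖v‖ = 1 →
      1 ≤ (l.map fun s => |inner ℝ s v|).sum ∧ (l.map fun s => |inner ℝ s v|).sum ≤ 1 + η := by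
  set e : EuclideanSpace ℝ (Fin n) := EuclideanSpace.basisFun (Fin n) ℝ ⟨0, hn⟩ with he_def
  have he : ‖e‖ = 1 := (EuclideanSpace.basisFun (Fin n) ℝ).orthonormal.1 _
  obtain ⟨c, hc, hcv⟩ := exists_integral_absInnerRot_eq he
  let W : Set C(Metric.sphere (0 : EuclideanSpace ℝ (Fin n)) 1, ℝ) :=
    {h | ∃ l : List (EuclideanSpace ℝ (Fin n)), ∀ v : Metric.sphere (0 : EuclideanSpace ℝ (Fin n)) 1,
      h v = (l.map fun s => |inner ℝ s (v : EuclideanSpace ℝ (Fin n))|).sum}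
  have hscale : ∀ (a : ℝ) (l : List (EuclideanSpace ℝ (Fin n))) (v : EuclideanSpace ℝ (Fin n)),
      0 ≤ a → ((l.map (a • ·)).map fun s => |inner ℝ s v|).sum =
        a * (l.map fun s => |inner ℝ s v|).sum := by
    intro a l v ha
    rw [List.map_map, ← List.sum_map_mul_left]
    congr 1
    refine List.map_congr_left fun s _ => ?_
    simp [inner_smul_left, abs_mul, abs_of_nonneg ha]
  have hW : Convex ℝ W := by
    rintro f ⟨l, hl⟩ h ⟨m, hm⟩ a b ha hb -
    refine ⟨l.map (a • ·) ++ m.map (b • ·), fun v => ?_⟩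
    rw [List.map_append, List.sum_append, hscale a l v ha, hscale b m v hb, ← hl, ← hm]
    rfl
  have hmem : (∫ g, absInnerRot e g ∂(haarO n)) ∈ closure W := by
    refine hW.closure.integral_mem isClosed_closure (Filter.Eventually.of_forall fun g => ?_)
      (integrable_of_continuous_haarO (absInnerRot e).continuous)
    refine subset_closure ⟨[rot g e], fun v => ?_⟩
    simp [absInnerRot_apply]
  -- With this `δ` one has `(c + δ) / (c - δ) = 1 + η`, so dividing by `c - δ` gives the required
  -- bounds.
  have hδ : 0 < c * η / (2 + η) := by positivity
  obtain ⟨h, ⟨l, hl⟩, hdist⟩ := Metric.mem_closure_iff.1 hmem _ hδ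
  set δ := c * η / (2 + η) with hδ_def
  have hcδ : 0 < c - δ := by
    have : c - δ = 2 * c / (2 + η) := by rw [hδ_def]; field_simp; ring
    rw [this]
    positivity
  refine ⟨l.map ((c - δ)⁻¹ • ·), fun v hv => ?_⟩
  rw [hscale _ _ _ (inv_nonneg.2 hcδ.le)]
  have hvS : v ∈ Metric.sphere (0 : EuclideanSpace ℝ (Fin n)) 1 := by simpa using hv
  have h1 := (ContinuousMap.dist_apply_le_dist (f := ∫ g, absInnerRot e g ∂(haarO n)) (g := h)
    ⟨v, hvS⟩).trans_lt hdist
  rw [hcv, hl, Real.dist_eq, abs_lt] at h1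
  rw [inv_mul_eq_div]
  constructor
  · rw [le_div_iff₀ hcδ]; linarith [h1.2]
  · rw [div_le_iff₀ hcδ]
    have : (1 + η) * (c - δ) = c + δ := by rw [hδ_def]; field_simp; ring
    rw [this]; linarith [h1.1]

theorem exists_zonotope_near_ball (hn : 1 ≤ n) {η : ℝ} (hη : 0 < η) :
    ∃ (l : List (EuclideanSpace ℝ (Fin n))) (c : EuclideanSpace ℝ (Fin n)),
      (∀ x ∈ Metric.closedBall (0 : EuclideanSpace ℝ (Fin n)) 1, x + c ∈ zonotope l) ∧
      ∀ z ∈ zonotope l, z - c ∈ Metric.closedBall (0 : EuclideanSpace ℝ (Fin n)) (1 + η) := by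
  obtain ⟨l, hl⟩ := exists_list_abs_inner_near_one hn hη
  obtain ⟨h1, h2⟩ := zonotope_near_ball hl
  refine ⟨_, l.sum, h1, fun z hz => ?_⟩
  rw [mem_closedBall_zero_iff]
  rcases h2 z hz with h | h
  · rw [h, norm_zero]; linarith
  · exact h

end BallApproximation

/-! ### Steiner's and Kubota's formulas -/

section Steiner

variable {n : ℕ}

theorem coeff_eq_zero_of_sum_eq_zero {b : ℕ → ℝ}
    (h : ∀ ε : ℝ, 0 < ε → ∑ k ∈ Finset.range (n + 1), ε ^ (n - k) * b k = 0) {k : ℕ}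
    (hk : k ≤ n) : b k = 0 := by
  set p : Polynomial ℝ := ∑ k ∈ Finset.range (n + 1), Polynomial.monomial (n - k) (b k) with hp
  have hp0 : p = 0 := by
    refine Polynomial.eq_of_infinite_eval_eq p 0 ((Set.Ioi_infinite (0 : ℝ)).mono fun ε hε => ?_)
    simp only [Set.mem_ofPred_eq, hp, Polynomial.eval_finsetSum, Polynomial.eval_monomial,
      Polynomial.eval_zero]
    rw [← h ε hε]
    exact Finset.sum_congr rfl fun _ _ => mul_comm _ _
  have h1 : p.coeff (n - k) = b k := by
    rw [hp, Polynomial.finsetSum_coeff, Finset.sum_eq_single k]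
    · simp
    · intro i hi hik
      rw [Polynomial.coeff_monomial, if_neg]
      have := Finset.mem_range.1 hi
      omega
    · intro hk'
      exact absurd (Finset.mem_range.2 (Nat.lt_succ_of_le hk)) hk'
  rw [← h1, hp0, Polynomial.coeff_zero]

theorem ballVolume_pos (m : ℕ) : 0 < ballVolume m :=
  ENNReal.toReal_pos (Metric.measure_closedBall_pos _ _ one_pos).ne'
    measure_closedBall_lt_top.ne

theorem ballVolume_zero : ballVolume 0 = 1 := by
  have h : Metric.closedBall (0 : EuclideanSpace ℝ (Fin 0)) 1 = Set.univ :=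
    Set.eq_univ_of_forall fun x => by simp [Subsingleton.elim x 0]
  rw [ballVolume, h, Measure.real, volume_euclideanSpace_eq_dirac]
  simp

theorem volume_shadow_top (C : Set (EuclideanSpace ℝ (Fin n))) :
    volume (shadow C ⊤) = volume C := by
  set Φ := LinearIsometryEquiv.ofTop (EuclideanSpace ℝ (Fin n))
    (⊤ : Submodule ℝ (EuclideanSpace ℝ (Fin n))) rfl
  have h := Φ.measurePreserving.measure_preimage_equiv (f := Φ.toMeasurableEquiv) C
  rw [← h]
  congr 1
  ext x
  have hx : ∀ y : EuclideanSpace ℝ (Fin n),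
      (((⊤ : Submodule ℝ (EuclideanSpace ℝ (Fin n))).orthogonalProjectionOnto y :
        (⊤ : Submodule ℝ (EuclideanSpace ℝ (Fin n)))) : EuclideanSpace ℝ (Fin n)) = y :=
    fun y => Submodule.starProjection_eq_self_iff.2 Submodule.mem_top
  constructor
  · rintro ⟨y, hy, rfl⟩
    change ((⊤ : Submodule ℝ (EuclideanSpace ℝ (Fin n))).orthogonalProjectionOnto y :
      EuclideanSpace ℝ (Fin n)) ∈ C
    rwa [hx]
  · intro h
    exact ⟨x, h, Subtype.ext (hx x)⟩

theorem volume_image_rot (g : Matrix.orthogonalGroup (Fin n) ℝ)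
    (C : Set (EuclideanSpace ℝ (Fin n))) : volume (rot g '' C) = volume C := by
  have h := (rot g).measurePreserving.measure_preimage_equiv (f := (rot g).toMeasurableEquiv)
    (rot g '' C)
  rw [← h]
  congr 1
  exact (rot g).injective.preimage_image C

theorem meanShadow_self {C : Set (EuclideanSpace ℝ (Fin n))} (hC : IsCompact C) :
    meanShadow n C = volume.real C := by
  have h := integral_volume_shadow_rot hC ⊤
  rw [finrank_top, finrank_euclideanSpace_fin] at h
  rw [← h]
  simp only [Measure.real, volume_shadow_top, volume_image_rot]
  simp

theorem meanShadow_nonneg (j : ℕ) (C : Set (EuclideanSpace ℝ (Fin n))) : 0 ≤ meanShadow j C :=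
  integral_nonneg fun _ => measureReal_nonneg

theorem meanShadow_empty (j : ℕ) : meanShadow j (∅ : Set (EuclideanSpace ℝ (Fin n))) = 0 := by
  simp [meanShadow, shadow]

theorem meanShadow_smul (j : ℕ) {r : ℝ} (hr : 0 ≤ r) (C : Set (EuclideanSpace ℝ (Fin n))) :
    meanShadow j (r • C) = r ^ j * meanShadow j C := by
  rw [meanShadow, meanShadow, ← integral_const_mul]
  refine integral_congr_ae (Filter.Eventually.of_forall fun H => ?_)
  have h : shadow (r • C) H.1 = r • shadow C H.1 := by
    rw [shadow, shadow, Set.image_smul_comm]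
    exact fun x => map_smul _ _ _
  simp only [h]
  rw [Measure.real, Measure.addHaar_smul, H.2, ENNReal.toReal_mul,
    ENNReal.toReal_ofReal (abs_nonneg _), abs_of_nonneg (pow_nonneg hr _)]
  rfl

theorem shadow_closedBall (H : Submodule ℝ (EuclideanSpace ℝ (Fin n))) :
    shadow (Metric.closedBall 0 1) H = Metric.closedBall 0 1 := by
  ext x
  constructor
  · rintro ⟨y, hy, rfl⟩
    rw [mem_closedBall_zero_iff] at hy ⊢
    exact (H.norm_orthogonalProjectionOnto_apply_le y).trans hy
  · intro hx
    refine ⟨x, ?_, H.orthogonalProjectionOnto_mem_subspace_eq_self x⟩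
    rw [mem_closedBall_zero_iff] at hx ⊢
    exact hx

theorem volume_real_closedBall_submodule (H : Submodule ℝ (EuclideanSpace ℝ (Fin n))) :
    volume.real (Metric.closedBall (0 : H) 1) = ballVolume (Module.finrank ℝ H) := by
  rw [ballVolume, Measure.real, Measure.real]
  congr 1
  set Φ := (stdOrthonormalBasis ℝ H).repr
  have h := Φ.measurePreserving.measure_preimage_equiv (f := Φ.toMeasurableEquiv)
    (Metric.closedBall 0 1)
  rw [← h]
  congr 1
  have := Φ.preimage_closedBall 0 1
  rw [map_zero] at this
  exact this.symm

theorem isProbabilityMeasure_grMeasure {j : ℕ} (hj : j ≤ n) :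
    IsProbabilityMeasure (grMeasure n j) := by
  rw [grMeasure_eq hj]
  exact Measure.isProbabilityMeasure_map (continuous_rotateGr _).measurable.aemeasurable

theorem meanShadow_closedBall {j : ℕ} (hj : j ≤ n) :
    meanShadow j (Metric.closedBall (0 : EuclideanSpace ℝ (Fin n)) 1) = ballVolume j := by
  have := isProbabilityMeasure_grMeasure hj
  have h : ∀ H : Gr n j, volume.real (shadow (Metric.closedBall 0 1) H.1) = ballVolume j := by
    intro H
    rw [shadow_closedBall, volume_real_closedBall_submodule, H.2]
  simp [meanShadow, h]

/-- By convexity `x + η x₀ ∈ (1 + η) C` for `x, x₀ ∈ C`, so a translate of the left-hand set lies in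
the dilate of `C + B` by `1 + η`. -/
theorem volume_real_add_closedBall_le {C : Set (EuclideanSpace ℝ (Fin n))} (hC : IsCompact C)
    (hconv : Convex ℝ C) (hne : C.Nonempty) {η : ℝ} (hη : 0 ≤ η) :
    volume.real (C + Metric.closedBall 0 (1 + η)) ≤
      (1 + η) ^ n * volume.real (C + Metric.closedBall 0 1) := by
  obtain ⟨x₀, hx₀⟩ := hne
  have hη1 : 0 < 1 + η := by linarith
  have hsub : (η • x₀) +ᵥ (C + Metric.closedBall (0 : EuclideanSpace ℝ (Fin n)) (1 + η)) ⊆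
      (1 + η) • (C + Metric.closedBall (0 : EuclideanSpace ℝ (Fin n)) 1) := by
    rintro _ ⟨_, ⟨x, hx, y, hy, rfl⟩, rfl⟩
    refine ⟨(1 + η)⁻¹ • (x + η • x₀) + (1 + η)⁻¹ • y, Set.add_mem_add ?_ ?_, ?_⟩
    · have h := hconv hx hx₀ (inv_nonneg.2 hη1.le) (mul_nonneg (inv_nonneg.2 hη1.le) hη)
        (by field_simp)
      rwa [mul_smul, ← smul_add] at h
    · rw [mem_closedBall_zero_iff] at hy ⊢
      rw [norm_smul, Real.norm_of_nonneg (inv_nonneg.2 hη1.le), inv_mul_le_one₀ hη1]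
      exact hy
    · simp only [smul_add, smul_inv_smul₀ hη1.ne', vadd_eq_add]
      abel
  have hcomp : IsCompact ((1 + η) • (C + Metric.closedBall (0 : EuclideanSpace ℝ (Fin n)) 1)) :=
    (hC.add (isCompact_closedBall _ _)).smul _
  have h := measureReal_mono (μ := volume) hsub hcomp.measure_lt_top.ne
  rw [Measure.real, Measure.real, measure_vadd, Measure.addHaar_smul,
    ENNReal.toReal_mul, ENNReal.toReal_ofReal (abs_nonneg _), finrank_euclideanSpace_fin,
    abs_of_nonneg (by positivity)] at h
  exact h

/-- Since balls are rotation invariant, `gC + rB` has the same volume for all `g`. The squeeze of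
the zonotope between balls therefore survives averaging over `g`. -/
theorem exists_coeff_near_steiner (hn : 1 ≤ n) {η : ℝ} (hη : 0 < η) :
    ∃ a : ℕ → ℝ, (∀ k, 0 ≤ a k) ∧ ∀ C : Set (EuclideanSpace ℝ (Fin n)), IsCompact C →
      Convex ℝ C → C.Nonempty →
      volume.real (C + Metric.closedBall 0 1) ≤
          ∑ k ∈ Finset.range (n + 1), a k * meanShadow k C ∧
        ∑ k ∈ Finset.range (n + 1), a k * meanShadow k C ≤
          (1 + η) ^ n * volume.real (C + Metric.closedBall 0 1) := by
  obtain ⟨l, c, hl1, hl2⟩ := exists_zonotope_near_ball hn hη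
  obtain ⟨a, ha0, ha⟩ := exists_coeff_integral_volume_add_zonotope l ⊤
  refine ⟨a, ha0, fun C hC hconv hne => ?_⟩
  obtain ⟨hint, heq⟩ := ha C hC hconv
  have hball : ∀ (g : Matrix.orthogonalGroup (Fin n) ℝ) (r : ℝ),
      volume.real (C + Metric.closedBall 0 r) =
        volume.real (rot g '' C + Metric.closedBall 0 r) := by
    intro g r
    have h : rot g '' (C + Metric.closedBall 0 r) = rot g '' C + Metric.closedBall 0 r := by
      rw [Set.image_add, image_rot_closedBall]
    rw [← h, Measure.real, Measure.real, volume_image_rot]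
  have hZ : ∀ g : Matrix.orthogonalGroup (Fin n) ℝ,
      IsCompact (rot g '' C + zonotope l) := fun g =>
    (hC.image (rot g).continuous).add (isCompact_zonotope l)
  have hlow : ∀ g : Matrix.orthogonalGroup (Fin n) ℝ,
      volume.real (C + Metric.closedBall 0 1) ≤
        volume.real (shadow (rot g⁻¹ '' C + zonotope l) ⊤) := by
    intro g
    rw [hball g⁻¹, Measure.real, Measure.real, volume_shadow_top, ← measure_vadd _ c]
    refine ENNReal.toReal_mono (hZ _).measure_lt_top.ne (measure_mono ?_)
    rintro _ ⟨_, ⟨x, hx, y, hy, rfl⟩, rfl⟩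
    refine ⟨x, hx, y + c, hl1 y hy, ?_⟩
    simp only [vadd_eq_add]
    abel
  have hupp : ∀ g : Matrix.orthogonalGroup (Fin n) ℝ,
      volume.real (shadow (rot g⁻¹ '' C + zonotope l) ⊤) ≤
        volume.real (C + Metric.closedBall 0 (1 + η)) := by
    intro g
    rw [hball g⁻¹, Measure.real, Measure.real, volume_shadow_top, ← measure_vadd _ (-c)]
    refine ENNReal.toReal_mono ((hC.image (rot g⁻¹).continuous).add
      (isCompact_closedBall _ _)).measure_lt_top.ne (measure_mono ?_)
    rintro _ ⟨_, ⟨x, hx, y, hy, rfl⟩, rfl⟩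
    refine ⟨x, hx, y - c, hl2 y hy, ?_⟩
    simp only [vadd_eq_add]
    abel
  rw [← heq]
  constructor
  · have h := integral_mono (integrable_const _) hint hlow
    simpa using h
  · have h := integral_mono hint (integrable_const _) hupp
    have h2 := volume_real_add_closedBall_le hC hconv hne hη.le
    refine le_trans ?_ h2
    simpa using h

theorem volume_real_closedBall_add (r : ℝ) (hr : 0 ≤ r) :
    volume.real (r • Metric.closedBall (0 : EuclideanSpace ℝ (Fin n)) 1 +
      Metric.closedBall 0 1) = (r + 1) ^ n * ballVolume n := by
  have h : r • Metric.closedBall (0 : EuclideanSpace ℝ (Fin n)) 1 + Metric.closedBall 0 1 =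
      (r + 1) • Metric.closedBall (0 : EuclideanSpace ℝ (Fin n)) 1 := by
    rw [(convex_closedBall _ _).add_smul hr zero_le_one, one_smul]
  rw [h, Measure.real, Measure.addHaar_smul, ENNReal.toReal_mul,
    ENNReal.toReal_ofReal (abs_nonneg _), finrank_euclideanSpace_fin,
    abs_of_nonneg (by positivity), ballVolume, Measure.real]

theorem exists_coeff_steiner (hn : 1 ≤ n) :
    ∃ a : ℕ → ℝ, ∀ C : Set (EuclideanSpace ℝ (Fin n)), IsCompact C → Convex ℝ C → C.Nonempty →
      volume.real (C + Metric.closedBall 0 1) =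
          ∑ k ∈ Finset.range (n + 1), a k * meanShadow k C := by
  have hη : ∀ m : ℕ, (0 : ℝ) < 1 / ((m : ℝ) + 1) := fun m => Nat.one_div_pos_of_nat
  choose a ha0 ha using fun m : ℕ => exists_coeff_near_steiner hn (hη m)
  set B : Set (EuclideanSpace ℝ (Fin n)) := Metric.closedBall 0 1 with hB
  have hBne : B.Nonempty := ⟨0, by simp [hB]⟩
  -- Testing on the unit ball bounds every coefficient uniformly in `m`, as all terms are
  -- nonnegative and `1 + 1 / (m + 1) ≤ 2`.
  have hbound : ∀ m k, k ≤ n → a m k ≤ 2 ^ n * volume.real (B + B) / ballVolume k := by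
    intro m k hk
    rw [le_div_iff₀ (ballVolume_pos k)]
    have h1 := (ha m B (isCompact_closedBall _ _) (convex_closedBall _ _) hBne).2
    have h2 : a m k * ballVolume k ≤ ∑ k ∈ Finset.range (n + 1), a m k * meanShadow k B := by
      rw [← meanShadow_closedBall hk]
      exact Finset.single_le_sum (f := fun k => a m k * meanShadow k B)
        (fun i _ => mul_nonneg (ha0 m i) (meanShadow_nonneg i B))
        (Finset.mem_range.2 (Nat.lt_succ_of_le hk))
    refine h2.trans (h1.trans (mul_le_mul_of_nonneg_right ?_ measureReal_nonneg))
    refine pow_le_pow_left₀ (by linarith [hη m]) ?_ n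
    have : (1 : ℝ) / ((m : ℝ) + 1) ≤ 1 := by
      rw [div_le_one (by positivity)]
      linarith [(Nat.cast_nonneg m : (0 : ℝ) ≤ m)]
    linarith
  have hmem : ∀ m, (fun k : Fin (n + 1) => a m k) ∈ Set.Icc (0 : Fin (n + 1) → ℝ)
      (fun k => 2 ^ n * volume.real (B + B) / ballVolume k) := fun m =>
    ⟨fun k => ha0 m k, fun k => hbound m k (Nat.lt_succ_iff.1 k.2)⟩
  -- The subsequence is extracted before `C` is introduced, so the limit coefficients serve all
  -- bodies.
  obtain ⟨b, -, φ, hφ, hb⟩ := isCompact_Icc.tendsto_subseq hmem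
  refine ⟨fun k => if h : k < n + 1 then b ⟨k, h⟩ else 0, fun C hC hconv hne => ?_⟩
  have hsum : ∀ f : ℕ → ℝ, ∑ k ∈ Finset.range (n + 1), f k * meanShadow k C =
      ∑ k : Fin (n + 1), f k * meanShadow k C := fun f =>
    Finset.sum_range fun k => f k * meanShadow k C
  have hlim : Filter.Tendsto
      (fun m => ∑ k ∈ Finset.range (n + 1), a (φ m) k * meanShadow k C) Filter.atTop
      (nhds (∑ k : Fin (n + 1), b k * meanShadow k C)) := by
    simp only [hsum]
    refine tendsto_finsetSum _ fun k _ => ?_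
    exact ((tendsto_pi_nhds.1 hb) k).mul_const _
  have hone : Filter.Tendsto
      (fun m => (1 + 1 / ((φ m : ℝ) + 1)) ^ n * volume.real (C + Metric.closedBall 0 1))
      Filter.atTop (nhds (volume.real (C + Metric.closedBall 0 1))) := by
    have h1 : Filter.Tendsto (fun m : ℕ => 1 / ((φ m : ℝ) + 1)) Filter.atTop (nhds 0) :=
      (tendsto_one_div_add_atTop_nhds_zero_nat (𝕜 := ℝ)).comp hφ.tendsto_atTop
    have h2 := ((h1.const_add 1).pow n).mul_const (volume.real (C + Metric.closedBall 0 1))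
    simpa using h2
  rw [hsum]
  simp only [Fin.is_lt, dif_pos, Fin.eta]
  refine tendsto_nhds_unique ?_ hlim
  exact tendsto_of_tendsto_of_tendsto_of_le_of_le tendsto_const_nhds hone
    (fun m => (ha (φ m) C hC hconv hne).1) (fun m => (ha (φ m) C hC hconv hne).2)

/-- On balls of radius `ε⁻¹` both sides become polynomials in `ε` after multiplication by `ε ^ n`;
the binomial theorem identifies the coefficients. -/
theorem coeff_steiner_eq {a : ℕ → ℝ}
    (ha : ∀ C : Set (EuclideanSpace ℝ (Fin n)), IsCompact C → Convex ℝ C → C.Nonempty →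
      volume.real (C + Metric.closedBall 0 1) =
        ∑ k ∈ Finset.range (n + 1), a k * meanShadow k C) {k : ℕ} (hk : k ≤ n) :
    a k = n.choose k * ballVolume n / ballVolume k := by
  rw [eq_div_iff (ballVolume_pos k).ne', ← sub_eq_zero]
  have key : ∀ ε : ℝ, 0 < ε → ∑ k ∈ Finset.range (n + 1), ε ^ (n - k) *
      (a k * ballVolume k - n.choose k * ballVolume n) = 0 := by
    intro ε hε
    have h := ha (ε⁻¹ • Metric.closedBall 0 1) ((isCompact_closedBall _ _).smul _)
      ((convex_closedBall _ _).smul _)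
      (Set.Nonempty.smul_set ⟨0, by simp⟩)
    rw [volume_real_closedBall_add _ (inv_nonneg.2 hε.le)] at h
    have h1 : ε ^ n * ((ε⁻¹ + 1) ^ n * ballVolume n) =
        ∑ k ∈ Finset.range (n + 1), ε ^ (n - k) * (n.choose k * ballVolume n) := by
      rw [← mul_assoc, ← mul_pow, mul_add, mul_inv_cancel₀ hε.ne', mul_one, add_pow,
        Finset.sum_mul]
      refine Finset.sum_congr rfl fun k _ => ?_
      rw [one_pow]; ring
    have h2 : ε ^ n * ∑ k ∈ Finset.range (n + 1),
        a k * meanShadow k (ε⁻¹ • Metric.closedBall (0 : EuclideanSpace ℝ (Fin n)) 1) =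
        ∑ k ∈ Finset.range (n + 1), ε ^ (n - k) * (a k * ballVolume k) := by
      rw [Finset.mul_sum]
      refine Finset.sum_congr rfl fun k hk => ?_
      have hkn := Nat.lt_succ_iff.1 (Finset.mem_range.1 hk)
      rw [meanShadow_smul k (inv_nonneg.2 hε.le), meanShadow_closedBall hkn, pow_sub₀ ε hε.ne' hkn,
        inv_pow]
      ring
    simp only [mul_sub, Finset.sum_sub_distrib]
    rw [← h1, ← h2, h, sub_self]
  exact coeff_eq_zero_of_sum_eq_zero key hk

theorem flagCoeff_mul_ballVolume (j : ℕ) :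
    ballVolume (n - j) * flagCoeff n j = n.choose j * ballVolume n / ballVolume j := by
  have h1 := (ballVolume_pos (n - j)).ne'
  have h2 := (ballVolume_pos j).ne'
  rw [flagCoeff]
  field_simp

theorem flagCoeff_self : flagCoeff n n = 1 := by
  have h := (ballVolume_pos n).ne'
  rw [flagCoeff, Nat.sub_self, ballVolume_zero, Nat.choose_self]
  field_simp
  simp

theorem flagCoeff_nonneg (n j : ℕ) : 0 ≤ flagCoeff n j :=
  mul_nonneg (Nat.cast_nonneg _) (div_nonneg (ballVolume_pos n).le
    (mul_nonneg (ballVolume_pos j).le (ballVolume_pos _).le))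

/-- Steiner's formula, with the coefficients given by Kubota's formula. -/
theorem isSteinerCoeff_meanShadow (hn : 1 ≤ n) {C : Set (EuclideanSpace ℝ (Fin n))}
    (hC : IsCompact C) (hconv : Convex ℝ C) :
    IsSteinerCoeff C fun j => flagCoeff n j * meanShadow j C := by
  intro ε hε
  rcases C.eq_empty_or_nonempty with rfl | hne
  · simp [meanShadow_empty]
  -- The main argument divides by `ε`. At `ε = 0` only the index `j = n` survives, because `0 ^ 0 =
  -- 1`.
  rcases hε.eq_or_lt with rfl | hε
  · rw [Fin.sum_univ_castSucc, Finset.sum_eq_zero]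
    · rw [Set.zero_smul_set ⟨0, by simp⟩]
      simp [ballVolume_zero, flagCoeff_self, meanShadow_self hC]
    · intro j _
      rw [zero_pow (by simp; omega)]
      simp
  obtain ⟨a, ha⟩ := exists_coeff_steiner hn
  -- Radius `ε` is reduced to radius `1` by dilation; homogeneity of degree `k` of the mean shadow
  -- turns the factor `ε ^ n` into `ε ^ (n - k)`.
  have h := ha (ε⁻¹ • C) (hC.smul _) (hconv.smul _) hne.smul_set
  have hset : C + ε • Metric.closedBall (0 : EuclideanSpace ℝ (Fin n)) 1 =
      ε • (ε⁻¹ • C + Metric.closedBall 0 1) := by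
    rw [smul_add, smul_inv_smul₀ hε.ne']
  rw [hset, Measure.real, Measure.addHaar_smul, ENNReal.toReal_mul,
    ENNReal.toReal_ofReal (abs_nonneg _), finrank_euclideanSpace_fin,
    abs_of_nonneg (by positivity), ← Measure.real, h, Finset.mul_sum,
    Finset.sum_range fun k => ε ^ n * (a k * meanShadow k (ε⁻¹ • C))]
  refine Finset.sum_congr rfl fun k _ => ?_
  have hkn := Nat.lt_succ_iff.1 k.2
  rw [meanShadow_smul _ (inv_nonneg.2 hε.le), coeff_steiner_eq ha hkn,
    ← flagCoeff_mul_ballVolume, pow_sub₀ ε hε.ne' hkn, inv_pow]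
  ring

theorem IsSteinerCoeff.unique {C : Set (EuclideanSpace ℝ (Fin n))} {V W : Fin (n + 1) → ℝ}
    (hV : IsSteinerCoeff C V) (hW : IsSteinerCoeff C W) : V = W := by
  funext j
  have key : ∀ ε : ℝ, 0 < ε → ∑ k ∈ Finset.range (n + 1), ε ^ (n - k) *
      (if h : k < n + 1 then ballVolume (n - k) * (V ⟨k, h⟩ - W ⟨k, h⟩) else 0) = 0 := by
    intro ε hε
    rw [Finset.sum_range]
    simp only [Fin.is_lt, dif_pos, Fin.eta, mul_sub, Finset.sum_sub_distrib, ← mul_assoc]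
    rw [← hV ε hε.le, ← hW ε hε.le, sub_self]
  have h := coeff_eq_zero_of_sum_eq_zero key (Nat.lt_succ_iff.1 j.2)
  rw [dif_pos j.2] at h
  exact sub_eq_zero.1 ((mul_eq_zero.1 h).resolve_left (ballVolume_pos _).ne')

/-- Kubota's formula. -/
theorem intrinsicVolume_eq (hn : 1 ≤ n) {C : Set (EuclideanSpace ℝ (Fin n))}
    (hC : IsCompact C) (hconv : Convex ℝ C) {j : ℕ} (hj : j ≤ n) :
    intrinsicVolume j C = flagCoeff n j * meanShadow j C := by
  have h := isSteinerCoeff_meanShadow hn hC hconv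
  have hc : (∃ V, IsSteinerCoeff C V) ∧ j < n + 1 := ⟨⟨_, h⟩, Nat.lt_succ_of_le hj⟩
  rw [intrinsicVolume, dif_pos hc, hc.1.choose_spec.unique h]

end Steiner

/-! ### The uniform measure on the sphere -/

section Sphere

variable {n : ℕ}

/-- The action of the orthogonal group on the unit sphere. -/
noncomputable def rotSphere (g : Matrix.orthogonalGroup (Fin n) ℝ)
    (u : Metric.sphere (0 : EuclideanSpace ℝ (Fin n)) 1) :
    Metric.sphere (0 : EuclideanSpace ℝ (Fin n)) 1 :=
  ⟨rot g u, by simp⟩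

theorem continuous_rotSphere (g : Matrix.orthogonalGroup (Fin n) ℝ) :
    Continuous (rotSphere g) :=
  ((rot g).continuous.comp continuous_subtype_val).subtype_mk _

theorem coe_image_preimage_rotSphere (g : Matrix.orthogonalGroup (Fin n) ℝ)
    (s : Set (Metric.sphere (0 : EuclideanSpace ℝ (Fin n)) 1)) :
    ((↑) '' (rotSphere g ⁻¹' s) : Set (EuclideanSpace ℝ (Fin n))) = rot g⁻¹ '' ((↑) '' s) := by
  ext x
  constructor
  · rintro ⟨u, hu, rfl⟩
    exact ⟨rot g u, ⟨_, hu, rfl⟩, rot_inv_apply_rot g _⟩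
  · rintro ⟨_, ⟨u, hu, rfl⟩, rfl⟩
    refine ⟨rotSphere g⁻¹ u, ?_, rfl⟩
    have h : rotSphere g (rotSphere g⁻¹ u) = u := Subtype.ext (rot_apply_rot_inv g _)
    rwa [Set.mem_preimage, h]

/-- The surface measure of a set is, up to a constant, the volume of the cone over it, and rotations
commute with forming cones. -/
theorem map_rotSphere_toSphere (g : Matrix.orthogonalGroup (Fin n) ℝ) :
    (volume : Measure (EuclideanSpace ℝ (Fin n))).toSphere.map (rotSphere g) =
      (volume : Measure (EuclideanSpace ℝ (Fin n))).toSphere := by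
  have hm := (continuous_rotSphere g).measurable
  ext s hs
  rw [Measure.map_apply hm hs, Measure.toSphere_apply' _ (hm hs), Measure.toSphere_apply' _ hs,
    coe_image_preimage_rotSphere]
  have h : Set.Ioo (0 : ℝ) 1 • (rot g⁻¹ '' ((↑) '' s)) =
      rot g⁻¹ '' (Set.Ioo (0 : ℝ) 1 • ((↑) '' s)) :=
    (Set.image_image2_distrib_right fun c x => map_smul (rot g⁻¹) c x).symm
  rw [h, volume_image_rot]

theorem map_rotSphere_sphereUniform (g : Matrix.orthogonalGroup (Fin n) ℝ) :
    (sphereUniform n).map (rotSphere g) = sphereUniform n := by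
  rw [sphereUniform, Measure.map_smul, map_rotSphere_toSphere]

theorem isProbabilityMeasure_sphereUniform (hn : 1 ≤ n) :
    IsProbabilityMeasure (sphereUniform n) := by
  have : Nonempty (Fin n) := ⟨⟨0, hn⟩⟩
  have : Nontrivial (EuclideanSpace ℝ (Fin n)) := inferInstance
  constructor
  rw [sphereUniform, Measure.smul_apply, smul_eq_mul]
  exact ENNReal.inv_mul_cancel
    (Measure.measure_univ_ne_zero.2 (Measure.toSphere_ne_zero _)) (measure_ne_top _ _)

/-- Integrate `f (g u)` over both `g` and `u`. The integral over `g` does not depend on `u`, by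
transitivity and right invariance, and the one over `u` does not depend on `g`; Fubini equates them.
-/
theorem integral_rot_apply_eq_integral_sphere (hn : 1 ≤ n) {f : EuclideanSpace ℝ (Fin n) → ℝ}
    (hf : Continuous f) {e : EuclideanSpace ℝ (Fin n)} (he : ‖e‖ = 1) :
    ∫ g, f (rot g e) ∂(haarO n) =
      ∫ u : Metric.sphere (0 : EuclideanSpace ℝ (Fin n)) 1, f u ∂(sphereUniform n) := by
  have := isProbabilityMeasure_sphereUniform hn
  have h1 : ∀ u : Metric.sphere (0 : EuclideanSpace ℝ (Fin n)) 1,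
      ∫ g, f (rot g u) ∂(haarO n) = ∫ g, f (rot g e) ∂(haarO n) := by
    intro u
    obtain ⟨h, hh⟩ := exists_rot_apply_eq (v := e) (w := u) (by rw [he, norm_eq_of_mem_sphere])
    rw [← integral_mul_right_eq_self (fun g => f (rot g e)) h]
    simp only [rot_mul_apply, hh]
  have h2 : ∀ g, ∫ u : Metric.sphere (0 : EuclideanSpace ℝ (Fin n)) 1,
      f (rot g u) ∂(sphereUniform n) =
      ∫ u : Metric.sphere (0 : EuclideanSpace ℝ (Fin n)) 1, f u ∂(sphereUniform n) := by
    intro g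
    have h := integral_map (μ := sphereUniform n) (continuous_rotSphere g).measurable.aemeasurable
      (hf.comp continuous_subtype_val).aestronglyMeasurable
    rw [map_rotSphere_sphereUniform] at h
    exact h.symm
  have hc : Continuous fun p : Metric.sphere (0 : EuclideanSpace ℝ (Fin n)) 1 ×
      Matrix.orthogonalGroup (Fin n) ℝ => f (rot p.2 p.1) :=
    hf.comp (continuous_snd.rot_apply (continuous_subtype_val.comp continuous_fst))
  have hint : Integrable (fun p : Metric.sphere (0 : EuclideanSpace ℝ (Fin n)) 1 ×
      Matrix.orthogonalGroup (Fin n) ℝ => f (rot p.2 p.1))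
      ((sphereUniform n).prod (haarO n)) :=
    hc.integrable_of_hasCompactSupport (HasCompactSupport.of_compactSpace _)
  have h3 := integral_integral_swap
    (f := fun (u : Metric.sphere (0 : EuclideanSpace ℝ (Fin n)) 1) g => f (rot g u)) hint
  simp only [h1, h2] at h3
  simpa using h3

end Sphere

/-! ### Support functions and shadows on lines -/

section Support

variable {n : ℕ}

theorem continuous_supportFn {C : Set (EuclideanSpace ℝ (Fin n))} (hC : IsCompact C) :
    Continuous (supportFn C) :=
  hC.continuous_sSup (f := fun u x => inner ℝ x u) (continuous_snd.inner continuous_fst)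

theorem le_supportFn {C : Set (EuclideanSpace ℝ (Fin n))} (hC : IsCompact C)
    {x : EuclideanSpace ℝ (Fin n)} (hx : x ∈ C) (u : EuclideanSpace ℝ (Fin n)) :
    inner ℝ x u ≤ supportFn C u :=
  le_csSup (hC.image (continuous_id.inner continuous_const)).bddAbove ⟨x, hx, rfl⟩

theorem supportFn_le {C : Set (EuclideanSpace ℝ (Fin n))} (hne : C.Nonempty)
    {u : EuclideanSpace ℝ (Fin n)} {a : ℝ} (h : ∀ x ∈ C, inner ℝ x u ≤ a) :
    supportFn C u ≤ a :=
  csSup_le (hne.image _) (by rintro _ ⟨x, hx, rfl⟩; exact h x hx)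

theorem isCompact_convexHull_union {K L : Set (EuclideanSpace ℝ (Fin n))} (hK : IsCompact K)
    (hL : IsCompact L) (hKc : Convex ℝ K) (hLc : Convex ℝ L) (hKn : K.Nonempty)
    (hLn : L.Nonempty) : IsCompact (convexHull ℝ (K ∪ L)) := by
  have h : convexHull ℝ (K ∪ L) =
      (fun p : (EuclideanSpace ℝ (Fin n) × EuclideanSpace ℝ (Fin n)) × ℝ =>
        p.1.1 + p.2 • (p.1.2 - p.1.1)) '' ((K ×ˢ L) ×ˢ Set.Icc 0 1) := by
    rw [hKc.convexHull_union hLc hKn hLn]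
    ext z
    simp only [mem_convexJoin, segment_eq_image', Set.mem_image, Set.mem_prod, Prod.exists]
    constructor
    · rintro ⟨x, hx, y, hy, t, ht, rfl⟩
      exact ⟨x, y, t, ⟨⟨hx, hy⟩, ht⟩, rfl⟩
    · rintro ⟨x, y, t, ⟨⟨hx, hy⟩, ht⟩, rfl⟩
      exact ⟨x, hx, y, hy, t, ht, rfl⟩
  rw [h]
  exact ((hK.prod hL).prod isCompact_Icc).image (by fun_prop)

theorem supportFn_convexHull_union {K L : Set (EuclideanSpace ℝ (Fin n))} (hK : IsCompact K)
    (hL : IsCompact L) (hKc : Convex ℝ K) (hLc : Convex ℝ L) (hKn : K.Nonempty)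
    (hLn : L.Nonempty) (u : EuclideanSpace ℝ (Fin n)) :
    supportFn (convexHull ℝ (K ∪ L)) u = max (supportFn K u) (supportFn L u) := by
  have hM := isCompact_convexHull_union hK hL hKc hLc hKn hLn
  have hsub := subset_convexHull ℝ (K ∪ L)
  apply le_antisymm
  · refine supportFn_le (hKn.mono (Set.subset_union_left.trans hsub)) ?_
    refine convexHull_min (s := K ∪ L)
      (t := {x | inner ℝ x u ≤ max (supportFn K u) (supportFn L u)}) ?_ ?_
    · rintro x (hx | hx)
      · exact (le_supportFn hK hx u).trans (le_max_left _ _)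
      · exact (le_supportFn hL hx u).trans (le_max_right _ _)
    · exact convex_halfSpace_le ⟨fun x y => inner_add_left x y u,
        fun c x => real_inner_smul_left x u c⟩ _
  · refine max_le (supportFn_le hKn fun x hx => le_supportFn hM (hsub (Or.inl hx)) u)
      (supportFn_le hLn fun x hx => le_supportFn hM (hsub (Or.inr hx)) u)

/-- In the coordinate `⟪x, e⟫` the shadow is the interval from `-h(-e)` to `h(e)`. -/
theorem volume_real_shadow_span_singleton {D : Set (EuclideanSpace ℝ (Fin n))} (hD : IsCompact D)
    (hconv : Convex ℝ D) (hne : D.Nonempty) {e : EuclideanSpace ℝ (Fin n)} (he : ‖e‖ = 1) :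
    volume.real (shadow D (Submodule.span ℝ {e})) = supportFn D e + supportFn D (-e) := by
  set Φ := LinearIsometryEquiv.toSpanUnitSingleton (𝕜 := ℝ) e he
  set S : Set ℝ := (fun x => inner ℝ x e) '' D with hS
  have hΦ : shadow D (Submodule.span ℝ {e}) = Φ '' S := by
    rw [shadow, hS, Set.image_image]
    refine Set.image_congr' fun x => Subtype.ext ?_
    have h : (Submodule.span ℝ {e}).starProjection x = inner ℝ e x • e :=
      Submodule.starProjection_unit_singleton ℝ he x
    refine h.trans ?_
    rw [LinearIsometryEquiv.toSpanUnitSingleton_apply, real_inner_comm]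
  have hvol : volume (shadow D (Submodule.span ℝ {e})) = volume S := by
    have h := Φ.measurePreserving.measure_preimage_equiv (f := Φ.toMeasurableEquiv) (Φ '' S)
    rw [hΦ, ← h]
    congr 1
    exact Φ.injective.preimage_image S
  have hSc : IsCompact S := hD.image (continuous_id.inner continuous_const)
  have hSconv : Convex ℝ S := hconv.is_linear_image
    ⟨fun x y => inner_add_left x y e, fun c x => real_inner_smul_left x e c⟩
  have hSne : S.Nonempty := hne.image _
  have hneg : supportFn D (-e) = -sInf S := by
    rw [Real.sInf_def, neg_neg, supportFn, ← Set.image_neg_eq_neg, hS, Set.image_image]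
    simp only [inner_neg_right]
  have hIcc := eq_Icc_of_connected_compact ⟨hSne, hSconv.isPreconnected⟩ hSc
  rw [Measure.real, hvol, hneg, hIcc, Real.volume_Icc, ENNReal.toReal_ofReal, ← hIcc]
  · rfl
  · exact sub_nonneg.2 (Real.sInf_le_sSup _ hSc.bddBelow hSc.bddAbove)

theorem supportFn_image_rot_inv (g : Matrix.orthogonalGroup (Fin n) ℝ)
    (C : Set (EuclideanSpace ℝ (Fin n))) (u : EuclideanSpace ℝ (Fin n)) :
    supportFn (rot g⁻¹ '' C) u = supportFn C (rot g u) := by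
  rw [supportFn, supportFn, Set.image_image]
  have h : ∀ x, inner ℝ (rot g⁻¹ x) u = inner ℝ x (rot g u) := by
    intro x
    rw [← (rot g).inner_map_map, rot_apply_rot_inv]
  simp only [h]

/-- The width is `h(g e) + h(-g e)`, and both terms have the same mean over rotations, whence the
factor `2`. -/
theorem meanShadow_one (hn : 1 ≤ n) {C : Set (EuclideanSpace ℝ (Fin n))} (hC : IsCompact C)
    (hconv : Convex ℝ C) (hne : C.Nonempty) :
    meanShadow 1 C = 2 * ∫ u : Metric.sphere (0 : EuclideanSpace ℝ (Fin n)) 1,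
      supportFn C u ∂(sphereUniform n) := by
  set e : EuclideanSpace ℝ (Fin n) := EuclideanSpace.basisFun (Fin n) ℝ ⟨0, hn⟩
  have he : ‖e‖ = 1 := (EuclideanSpace.basisFun (Fin n) ℝ).orthonormal.1 _
  have he' : ‖-e‖ = 1 := by rw [norm_neg, he]
  have hcont := continuous_supportFn hC
  have h := integral_volume_shadow_rot hC (Submodule.span ℝ {e})
  rw [finrank_span_singleton (norm_ne_zero_iff.1 (by rw [he]; exact one_ne_zero))] at h
  rw [← h]
  have h1 : ∀ g : Matrix.orthogonalGroup (Fin n) ℝ,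
      volume.real (shadow (rot g⁻¹ '' C) (Submodule.span ℝ {e})) =
        supportFn C (rot g e) + supportFn C (rot g (-e)) := by
    intro g
    rw [volume_real_shadow_span_singleton (hC.image (rot g⁻¹).continuous)
      (hconv.linear_image (rot g⁻¹).toLinearEquiv.toLinearMap) (hne.image _) he,
      supportFn_image_rot_inv, supportFn_image_rot_inv]
  have hi : ∀ v : EuclideanSpace ℝ (Fin n),
      Integrable (fun g => supportFn C (rot g v)) (haarO n) := fun v =>
    integrable_of_continuous_haarO (hcont.comp (continuous_id.rot_apply continuous_const))
  simp only [h1]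
  rw [integral_add (hi e) (hi (-e)), integral_rot_apply_eq_integral_sphere hn hcont he,
    integral_rot_apply_eq_integral_sphere hn hcont he', two_mul]

theorem convex_union_of_finrank_eq_one {F : Type*} [NormedAddCommGroup F] [NormedSpace ℝ F]
    [FiniteDimensional ℝ F] (hF : Module.finrank ℝ F = 1) {A B : Set F} (hA : Convex ℝ A)
    (hB : Convex ℝ B) (hAB : (A ∩ B).Nonempty) : Convex ℝ (A ∪ B) := by
  let Φ : ℝ ≃ₗ[ℝ] F := LinearEquiv.ofFinrankEq ℝ F (by rw [hF, Module.finrank_self])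
  obtain ⟨x, hxA, hxB⟩ := hAB
  have h : Convex ℝ (Φ ⁻¹' A ∪ Φ ⁻¹' B) := by
    refine (IsPreconnected.union (Φ.symm x) ?_ ?_ ?_ ?_).convex
    · simpa using hxA
    · simpa using hxB
    · exact (hA.linear_preimage Φ.toLinearMap).isPreconnected
    · exact (hB.linear_preimage Φ.toLinearMap).isPreconnected
  have h2 : A ∪ B = Φ '' (Φ ⁻¹' A ∪ Φ ⁻¹' B) := by
    rw [← Set.preimage_union, Set.image_preimage_eq _ Φ.surjective]
  rw [h2]
  exact h.linear_image Φ.toLinearMap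

theorem shadow_union (K L : Set (EuclideanSpace ℝ (Fin n)))
    (H : Submodule ℝ (EuclideanSpace ℝ (Fin n))) :
    shadow (K ∪ L) H = shadow K H ∪ shadow L H :=
  Set.image_union _ _ _

/-- A common point of `K` and `L` makes their shadows on a line overlap, so the union of the shadows
is already convex; projection commutes with convex hulls. -/
theorem meanShadow_one_convexHull_union {K L : Set (EuclideanSpace ℝ (Fin n))}
    (hKc : Convex ℝ K) (hLc : Convex ℝ L) (hKL : (K ∩ L).Nonempty) :
    meanShadow 1 (convexHull ℝ (K ∪ L)) = meanShadow 1 (K ∪ L) := by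
  refine integral_congr_ae (Filter.Eventually.of_forall fun H => ?_)
  have h : shadow (convexHull ℝ (K ∪ L)) H.1 = shadow (K ∪ L) H.1 := by
    obtain ⟨x, hxK, hxL⟩ := hKL
    have hc : Convex ℝ (shadow (K ∪ L) H.1) := by
      rw [shadow_union]
      exact convex_union_of_finrank_eq_one H.2 (convex_shadow hKc _) (convex_shadow hLc _)
        ⟨_, ⟨x, hxK, rfl⟩, ⟨x, hxL, rfl⟩⟩
    exact (H.1.orthogonalProjectionOnto.toLinearMap.image_convexHull (K ∪ L)).trans
      hc.convexHull_eq
  simp only [h]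

end Support

/-! ### Comparison of the metrics -/

section Comparison

variable {n : ℕ}

theorem meanShadow_mono {j : ℕ} {C D : Set (EuclideanSpace ℝ (Fin n))} (h : C ⊆ D)
    (hC : IsCompact C) (hD : IsCompact D) : meanShadow j C ≤ meanShadow j D :=
  integral_mono (integrable_volume_shadow hC) (integrable_volume_shadow hD)
    fun H => volume_real_shadow_mono h hD H.1

theorem measureReal_symmDiff_eq_two_mul_union_sub {X : Type*} [MeasurableSpace X] {μ : Measure X} {A B : Set X}
    (hA : MeasurableSet A) (hB : MeasurableSet B) (hA' : μ A ≠ ⊤) (hB' : μ B ≠ ⊤) :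
    μ.real (A ∆ B) = 2 * μ.real (A ∪ B) - μ.real A - μ.real B := by
  have h1 : μ.real (A ∆ B) = μ.real (A \ B) + μ.real (B \ A) := by
    rw [Set.symmDiff_def]
    exact measureReal_union (disjoint_sdiff_sdiff) (hB.diff hA)
      (measure_ne_top_of_subset Set.sdiff_subset hA')
      (measure_ne_top_of_subset Set.sdiff_subset hB')
  have h2 := measureReal_sdiff_add_inter (μ := μ) (s := A) hB hA'
  have h3 := measureReal_sdiff_add_inter (μ := μ) (s := B) hA hB'
  have h4 := measureReal_union_add_inter (μ := μ) (s := A) hB hA' hB'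
  rw [Set.inter_comm] at h3
  linarith

theorem meanShadow_union_add_inter_le {j : ℕ} {K L : Set (EuclideanSpace ℝ (Fin n))}
    (hK : IsCompact K) (hL : IsCompact L) :
    meanShadow j (K ∪ L) + meanShadow j (K ∩ L) ≤ meanShadow j K + meanShadow j L := by
  have hKL : IsCompact (K ∩ L) := hK.inter hL
  simp only [meanShadow]
  rw [← integral_add (integrable_volume_shadow (hK.union hL)) (integrable_volume_shadow hKL),
    ← integral_add (integrable_volume_shadow hK) (integrable_volume_shadow hL)]
  refine integral_mono ((integrable_volume_shadow (hK.union hL)).add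
    (integrable_volume_shadow hKL))
    ((integrable_volume_shadow hK).add (integrable_volume_shadow hL)) fun H => ?_
  have hKs := isCompact_shadow hK H.1
  have hLs := isCompact_shadow hL H.1
  have h1 := measureReal_union_add_inter (μ := (volume : Measure H.1)) (s := shadow K H.1)
    hLs.isClosed.measurableSet hKs.measure_lt_top.ne hLs.measure_lt_top.ne
  have h2 : volume.real (shadow (K ∩ L) H.1) ≤ volume.real (shadow K H.1 ∩ shadow L H.1) :=
    measureReal_mono (Set.image_inter_subset _ _ _)
      (measure_ne_top_of_subset Set.inter_subset_left hKs.measure_lt_top.ne)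
  simp only [shadow_union]
  linarith

theorem integral_two_mul_sub_sub {X : Type*} [MeasurableSpace X] {μ : Measure X} {f p q : X → ℝ}
    (hf : Integrable f μ) (hp : Integrable p μ) (hq : Integrable q μ) :
    ∫ x, (2 * f x - p x - q x) ∂μ = 2 * ∫ x, f x ∂μ - ∫ x, p x ∂μ - ∫ x, q x ∂μ := by
  have h1 : ∫ x, (2 * f x - p x - q x) ∂μ = ∫ x, (2 * f x - p x) ∂μ - ∫ x, q x ∂μ :=
    integral_sub ((hf.const_mul 2).sub hp) hq
  rw [h1, integral_sub (hf.const_mul 2) hp, integral_const_mul]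

/-- The union of the shadows is the shadow of `K ∪ L`. That set need not be convex, so mean shadows
are used here for arbitrary compact sets. -/
theorem ivMetric_eq {j : ℕ} {K L : Set (EuclideanSpace ℝ (Fin n))}
    (hK : IsCompact K) (hL : IsCompact L) :
    ivMetric j K L =
      flagCoeff n j * (2 * meanShadow j (K ∪ L) - meanShadow j K - meanShadow j L) := by
  have h : ∀ H : Gr n j, volume.real (shadow K H.1 ∆ shadow L H.1) =
      2 * volume.real (shadow (K ∪ L) H.1) - volume.real (shadow K H.1) -
        volume.real (shadow L H.1) := by
    intro H
    have hKs := isCompact_shadow hK H.1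
    have hLs := isCompact_shadow hL H.1
    rw [shadow_union]
    exact measureReal_symmDiff_eq_two_mul_union_sub hKs.isClosed.measurableSet hLs.isClosed.measurableSet
      hKs.measure_lt_top.ne hLs.measure_lt_top.ne
  rw [ivMetric]
  simp only [h]
  rw [integral_two_mul_sub_sub (integrable_volume_shadow (hK.union hL))
    (integrable_volume_shadow hK) (integrable_volume_shadow hL)]
  rfl

theorem proposition2p5 (n : ℕ) (hn : 1 ≤ n) (K L : Set (EuclideanSpace ℝ (Fin n)))
    (hK : IsConvexBody K) (hL : IsConvexBody L) :
    (K ⊆ L → ∀ j : ℕ, 1 ≤ j → j ≤ n →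
      ivMetric j K L = ivHullDist j K L ∧
      ivHullDist j K L = ivDeviation j K L ∧
      ivDeviation j K L = intrinsicVolume j L - intrinsicVolume j K) ∧
    (∀ j : ℕ, 1 ≤ j → j ≤ n → ivMetric j K L ≤ min (ivHullDist j K L) (ivDeviation j K L)) ∧
    (∀ j : ℕ, 1 ≤ j → j ≤ n → |intrinsicVolume j K - intrinsicVolume j L| ≤ ivMetric j K L) ∧
    (ivMetric n K L ≤ ivHullDist n K L ∧
      ivMetric n K L = ivDeviation n K L ∧
      ivDeviation n K L = volume.real (K ∆ L)) ∧
    ((K ∩ L).Nonempty →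
      ivMetric 1 K L ≤ ivDeviation 1 K L ∧
      ivMetric 1 K L = ivHullDist 1 K L ∧
      ivHullDist 1 K L = 2 * flagCoeff n 1 *
        ∫ u : Metric.sphere (0 : EuclideanSpace ℝ (Fin n)) 1,
          |supportFn K u - supportFn L u| ∂(sphereUniform n)) := by
  have hKn : K.Nonempty := hK.interior_nonempty.mono interior_subset
  have hLn : L.Nonempty := hL.interior_nonempty.mono interior_subset
  have hMc : IsCompact (convexHull ℝ (K ∪ L)) := isCompact_convexHull_union hK.isCompact
    hL.isCompact hK.convex hL.convex hKn hLn
  have hUc : IsCompact (K ∪ L) := hK.isCompact.union hL.isCompact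
  have hIc : IsCompact (K ∩ L) := hK.isCompact.inter hL.isCompact
  have hVK : ∀ {j}, j ≤ n → intrinsicVolume j K = flagCoeff n j * meanShadow j K :=
    intrinsicVolume_eq hn hK.isCompact hK.convex
  have hVL : ∀ {j}, j ≤ n → intrinsicVolume j L = flagCoeff n j * meanShadow j L :=
    intrinsicVolume_eq hn hL.isCompact hL.convex
  have hVM : ∀ {j}, j ≤ n → intrinsicVolume j (convexHull ℝ (K ∪ L)) =
      flagCoeff n j * meanShadow j (convexHull ℝ (K ∪ L)) :=
    intrinsicVolume_eq hn hMc (convex_convexHull ℝ _)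
  -- The intersection may be empty or have empty interior; Kubota's formula covers these cases.
  have hVI : ∀ {j}, j ≤ n → intrinsicVolume j (K ∩ L) =
      flagCoeff n j * meanShadow j (K ∩ L) :=
    intrinsicVolume_eq hn hIc (hK.convex.inter hL.convex)
  have hδ : ∀ j, ivMetric j K L = flagCoeff n j *
      (2 * meanShadow j (K ∪ L) - meanShadow j K - meanShadow j L) := fun j =>
    ivMetric_eq hK.isCompact hL.isCompact
  have hρ : ∀ {j}, j ≤ n → ivHullDist j K L = flagCoeff n j *
      (2 * meanShadow j (convexHull ℝ (K ∪ L)) - meanShadow j K - meanShadow j L) := by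
    intro j hj
    rw [ivHullDist, hVK hj, hVL hj, hVM hj]
    ring
  have hΔ : ∀ {j}, j ≤ n → ivDeviation j K L = flagCoeff n j *
      (meanShadow j K + meanShadow j L - 2 * meanShadow j (K ∩ L)) := by
    intro j hj
    rw [ivDeviation, hVK hj, hVL hj, hVI hj]
    ring
  have hδρ : ∀ j, j ≤ n → ivMetric j K L ≤ ivHullDist j K L := by
    intro j hj
    rw [hδ, hρ hj]
    refine mul_le_mul_of_nonneg_left ?_ (flagCoeff_nonneg n j)
    linarith [meanShadow_mono (j := j) (subset_convexHull ℝ (K ∪ L)) hUc hMc]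
  have hδΔ : ∀ j, j ≤ n → ivMetric j K L ≤ ivDeviation j K L := by
    intro j hj
    rw [hδ, hΔ hj]
    refine mul_le_mul_of_nonneg_left ?_ (flagCoeff_nonneg n j)
    linarith [meanShadow_union_add_inter_le (j := j) hK.isCompact hL.isCompact]
  refine ⟨fun hKL j _ hj => ?_, fun j _ hj => le_min (hδρ j hj) (hδΔ j hj), fun j _ hj => ?_,
    ⟨hδρ n le_rfl, ?_, ?_⟩, fun hKL => ⟨hδΔ 1 hn, ?_, ?_⟩⟩
  · rw [hδ, hρ hj, hΔ hj, hVL hj, hVK hj, Set.union_eq_self_of_subset_left hKL,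
      Set.inter_eq_self_of_subset_left hKL, hL.convex.convexHull_eq]
    refine ⟨rfl, ?_, ?_⟩ <;> ring
  · have h1 := meanShadow_mono (j := j) (Set.subset_union_left (s := K) (t := L))
      hK.isCompact hUc
    have h2 := meanShadow_mono (j := j) (Set.subset_union_right (s := K) (t := L))
      hL.isCompact hUc
    rw [hδ, hVK hj, hVL hj, ← mul_sub, abs_mul, abs_of_nonneg (flagCoeff_nonneg n j)]
    refine mul_le_mul_of_nonneg_left ?_ (flagCoeff_nonneg n j)
    rw [abs_le]
    constructor <;> linarith
  · rw [hδ, hΔ le_rfl, meanShadow_self hK.isCompact, meanShadow_self hL.isCompact,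
      meanShadow_self hUc, meanShadow_self hIc]
    congr 1
    linarith [measureReal_union_add_inter (μ := volume) (s := K)
      hL.isCompact.isClosed.measurableSet hK.isCompact.measure_lt_top.ne
      hL.isCompact.measure_lt_top.ne]
  · rw [hΔ le_rfl, flagCoeff_self, one_mul, meanShadow_self hK.isCompact,
      meanShadow_self hL.isCompact, meanShadow_self hIc,
      measureReal_symmDiff_eq_two_mul_union_sub hK.isCompact.isClosed.measurableSet
        hL.isCompact.isClosed.measurableSet hK.isCompact.measure_lt_top.ne
        hL.isCompact.measure_lt_top.ne]
    linarith [measureReal_union_add_inter (μ := volume) (s := K)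
      hL.isCompact.isClosed.measurableSet hK.isCompact.measure_lt_top.ne
      hL.isCompact.measure_lt_top.ne]
  · rw [hδ, hρ hn, meanShadow_one_convexHull_union hK.convex hL.convex hKL]
  · have := isProbabilityMeasure_sphereUniform hn
    have hi : ∀ {C : Set (EuclideanSpace ℝ (Fin n))}, IsCompact C →
        Integrable (fun u : Metric.sphere (0 : EuclideanSpace ℝ (Fin n)) 1 => supportFn C u)
          (sphereUniform n) := fun hC =>
      ((continuous_supportFn hC).comp continuous_subtype_val).integrable_of_hasCompactSupport
        (HasCompactSupport.of_compactSpace _)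
    -- The identity `|a - b| = 2 max(a, b) - a - b` gives the integrand the same shape as `ρ_1`.
    have habs : ∀ u, |supportFn K u - supportFn L u| =
        2 * supportFn (convexHull ℝ (K ∪ L)) u - supportFn K u - supportFn L u := by
      intro u
      rw [supportFn_convexHull_union hK.isCompact hL.isCompact hK.convex hL.convex hKn hLn]
      rcases le_total (supportFn K u) (supportFn L u) with h | h
      · rw [max_eq_right h, abs_of_nonpos (sub_nonpos.2 h)]; ring
      · rw [max_eq_left h, abs_of_nonneg (sub_nonneg.2 h)]; ring
    simp only [habs]
    rw [integral_two_mul_sub_sub (hi hMc) (hi hK.isCompact) (hi hL.isCompact), hρ hn,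
      meanShadow_one hn hMc (convex_convexHull ℝ _)
        (hKn.mono (Set.subset_union_left.trans (subset_convexHull ℝ _))),
      meanShadow_one hn hK.isCompact hK.convex hKn, meanShadow_one hn hL.isCompact hL.convex hLn]
    ring

end Comparison
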